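/- Let $n\ge 1$ items have scores $\theta^\star\in\mathbb R^n$ with $\sum_i\theta^\star_i=0$, and put $\kappa(\theta^\star)=\max_i e^{\theta^\star_i}/\min_i e^{\theta^\star_i}$. Let the comparison graph $\mathcal G$ be an Erdős–Rényi random graph on $[n]$ with edge probability $p\in[0,1]$. For every edge $(i,j)$ of $\mathcal G$ with $i>j$ one observes $L\ge 1$ outcomes $y_{ji}^{(1)},\dots,y_{ji}^{(L)}\in\{0,1\}$, where $y_{ji}^{(l)}=1$ means that $i$ beats $j$; given $\mathcal G$ all outcomes are independent, and $\mathbb P(y_{ji}^{(l)}=1)=e^{\theta^\star_i}/(e^{\theta^\star_i}+e^{\theta^\star_j})$. The vanilla (unweighted) MLE is $$\widehat\theta=\arg\min_{\theta:\,\sum_i\theta_i=0}\; -\frac1L\sum_{(i,j)\in\mathcal G,\,i>j}\ \sum_{l=1}^L\log\Big(y_{ji}^{(l)}\tfrac{e^{\theta_i}}{e^{\theta_i}+e^{\theta_j}}+(1-y_{ji}^{(l)})\tfrac{e^{\theta_j}}{e^{\theta_i}+e^{\theta_j}}\Big).$$ For every $\kappa_0\ge1$ there are constants $C_1,C_2,C_3>0$,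 depending only on $\kappa_0$, such that the following holds. (i) For all $n,L\ge1$ and $p\in[0,1]$ with $p\ge C_1\frac{\log n}{n}$ and $npL\ge C_2\log^2 n$, and for every $\theta^\star$ with $\sum_i\theta^\star_i=0$ and $\kappa(\theta^\star)\le\kappa_0$, with probability at least $1-n^{-10}$ the vanilla MLE exists, is unique, and satisfies $$\|\widehat\theta-\theta^\star\|_\infty\le C_3\sqrt{\frac{\log n}{npL}}.$$ (ii) This rate is optimal: if $\kappa_0>1$, there is a constant $c>0$, depending only on $\kappa_0$, such that for all $n,L,p$ as in (i) and every estimator $\tilde\theta$ (any $\mathbb R^n$-valued function of the observed graph and outcomes) there is a $\theta^\star$ with $\sum_i\theta^\star_i=0$ and $\kappa(\theta^\star)\le\kappa_0$ for which $$\mathbb P_{\theta^\star}\Big(\|\tilde\theta-\theta^\star\|_\infty\ge c\sqrt{\frac{\log n}{npL}}\Big)\ge\frac12 .$$ -/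

import Mathlib

noncomputable section

namespace BTL

open MeasureTheory ProbabilityTheory

/-- Unordered pairs of distinct items, each represented once as `(i, j)` with `i > j`. -/
abbrev ItemPair (n : ℕ) : Type := {e : Fin n × Fin n // e.2 < e.1}

/-- The Bradley-Terry-Luce probability `e^{θ i} / (e^{θ i} + e^{θ j})` that `i` beats `j`. -/
def winProb {n : ℕ} (θ : Fin n → ℝ) (i j : Fin n) : unitInterval :=
  ⟨Real.exp (θ i) / (Real.exp (θ i) + Real.exp (θ j)), by positivity,
    div_le_one_of_le₀ (le_add_of_nonneg_right (Real.exp_pos _).le) (by positivity)⟩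

/-- The condition number `κ = max_i e^{θ i} / min_i e^{θ i}`. -/
def condNumber {n : ℕ} (θ : Fin n → ℝ) : ℝ :=
  (⨆ i, Real.exp (θ i)) / (⨅ i, Real.exp (θ i))

/-- A comparison graph, together with `L` potential outcomes for every pair `(i, j)`, `i > j`;
the outcome is `true` if `i` beats `j`. -/
abbrev Sample (n L : ℕ) : Type := SimpleGraph (Fin n) × (ItemPair n → Fin L → Bool)

/-- The law of a sample: an Erdős–Rényi comparison graph with edge probability `p` and,
independently of it, independent Bradley-Terry-Luce outcomes with scores `θ`. -/
def sampleLaw {n : ℕ} (L : ℕ) (p : unitInterval) (θ : Fin n → ℝ) : Measure (Sample n L) :=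
  (SimpleGraph.binomialRandom (Fin n) p).prod
    (Measure.pi fun e : ItemPair n => Measure.pi fun _ : Fin L =>
      bernoulliMeasure true false (winProb θ e.1.1 e.1.2))

/-- What the statistician sees: `none` at a pair that is not compared, and the `L` outcomes at a
pair that is an edge of the comparison graph. -/
abbrev Data (n L : ℕ) : Type := ItemPair n → Option (Fin L → Bool)

open Classical in
/-- The data observed in a sample; outcomes off the comparison graph are discarded. -/
def observe {n L : ℕ} (ω : Sample n L) : Data n L :=
  fun e => if ω.1.Adj e.1.1 e.1.2 then some (ω.2 e) else none

/-- The unweighted negative log-likelihood of the observed comparisons, divided by `L`. -/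
def negLogLik {n L : ℕ} (d : Data n L) (θ : Fin n → ℝ) : ℝ :=
  -(1 / (L : ℝ)) * ∑ e : ItemPair n,
    (d e).elim 0 fun y => ∑ l : Fin L,
      Real.log (if y l then Real.exp (θ e.1.1) / (Real.exp (θ e.1.1) + Real.exp (θ e.1.2))
        else Real.exp (θ e.1.2) / (Real.exp (θ e.1.1) + Real.exp (θ e.1.2)))

/-- `θ` is a vanilla maximum likelihood estimate: it minimizes the unweighted negative
log-likelihood over the vectors whose entries sum to zero. -/
def IsMLE {n L : ℕ} (d : Data n L) (θ : Fin n → ℝ) : Prop :=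
  ∑ i, θ i = 0 ∧ ∀ θ' : Fin n → ℝ, ∑ i, θ' i = 0 → negLogLik d θ ≤ negLogLik d θ'

/-- The score vectors under consideration: centered, with condition number at most `κ₀`. -/
def scoreClass (n : ℕ) (κ₀ : ℝ) : Set (Fin n → ℝ) :=
  {θ | ∑ i, θ i = 0 ∧ condNumber θ ≤ κ₀}

/-- The sampling regime `p ≥ C₁ log n / n` and `n p L ≥ C₂ log² n`, with `n, L ≥ 1`. -/
def Regime (C₁ C₂ : ℝ) (n L : ℕ) (p : unitInterval) : Prop :=
  1 ≤ n ∧ 1 ≤ L ∧ C₁ * (Real.log n / n) ≤ (p : ℝ) ∧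
    C₂ * Real.log n ^ 2 ≤ (n : ℝ) * (p : ℝ) * (L : ℝ)

/-- The rate `√(log n / (n p L))`. -/
def rate (n L : ℕ) (p : unitInterval) : ℝ :=
  √(Real.log n / ((n : ℝ) * (p : ℝ) * (L : ℝ)))

end BTL

end

/-!
The maximum likelihood equations say that the error `δ` of the estimate is a potential on the
comparison graph whose current, a monotone function of the potential drop along each edge,
balances the observation noise. Truncating these response functions bounds their slopes from
below, so that the flow is strongly monotone as soon as the graph has a spectral gap; the gap
comes from Cheeger's inequality and the edge expansion of Erdős–Rényi graphs. The energy estimate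
only controls `δ` in `ℓ²`. For the sup norm one deletes an item `m`: the potential of the reduced
network does not depend on the edges at `m`, hence is not aligned with them, and its distance to
`δ` is controlled in `ℓ²`; balancing the current at `m` then bounds `δ m`. Since `δ` turns out to
be small, the truncation is inactive and `δ` solves the original equations.

For the lower bound, raise the score of a single item `k` by a multiple of the rate. Compared with
fair coins this changes only the outcomes of the roughly `n p L` comparisons of `k`, and the
likelihood ratio has second moment at most `√n`. By Cauchy–Schwarz no estimator can be right about
more than a quarter of these `n` hypotheses on average.
-/

noncomputable section

namespace BTL

open MeasureTheory ProbabilityTheory Finset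

/-! ## Networks with monotone responses -/

section Zarantonello

variable {E : Type*} [NormedAddCommGroup E] [InnerProductSpace ℝ E]

lemma norm_sub_smul_sq_le {k μ : ℝ} (hk : 0 < k) (hμ : 0 ≤ μ) {w z : E} (hw : ‖w‖ ≤ k * ‖z‖)
    (hwz : μ * ‖z‖ ^ 2 ≤ inner ℝ w z) :
    ‖z - (μ / k ^ 2) • w‖ ^ 2 ≤ (1 - μ ^ 2 / k ^ 2) * ‖z‖ ^ 2 := by
  have hw2 : (μ / k ^ 2) ^ 2 * ‖w‖ ^ 2 ≤ μ ^ 2 / k ^ 2 * ‖z‖ ^ 2 :=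
    calc (μ / k ^ 2) ^ 2 * ‖w‖ ^ 2 ≤ (μ / k ^ 2) ^ 2 * (k * ‖z‖) ^ 2 := by gcongr
      _ = μ ^ 2 / k ^ 2 * ‖z‖ ^ 2 := by field_simp
  have hwz' : μ ^ 2 / k ^ 2 * ‖z‖ ^ 2 ≤ μ / k ^ 2 * inner ℝ w z :=
    calc μ ^ 2 / k ^ 2 * ‖z‖ ^ 2 = μ / k ^ 2 * (μ * ‖z‖ ^ 2) := by ring
      _ ≤ μ / k ^ 2 * inner ℝ w z := by gcongr
  rw [norm_sub_sq_real, inner_smul_right, norm_smul, mul_pow, Real.norm_eq_abs, sq_abs,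
    real_inner_comm]
  linarith

/-- Zarantonello's theorem. -/
theorem surjective_of_lipschitz_of_stronglyMonotone [CompleteSpace E] {T : E → E} {K : NNReal}
    (hT : LipschitzWith K T) {μ : ℝ} (hμ : 0 < μ)
    (hmono : ∀ x y, μ * ‖x - y‖ ^ 2 ≤ inner ℝ (T x - T y) (x - y)) : Function.Surjective T := by
  intro b
  set k : ℝ := max K μ
  have hk : 0 < k := hμ.trans_le (le_max_right _ _)
  set ρ : ℝ := 1 - μ ^ 2 / k ^ 2
  have hρ0 : 0 ≤ ρ := by
    refine sub_nonneg.2 (div_le_one_of_le₀ ?_ (by positivity))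
    gcongr
    exact le_max_right _ _
  have hρ1 : √ρ < 1 := by
    rw [Real.sqrt_lt' one_pos, one_pow]
    exact sub_lt_self _ (by positivity)
  let Φ : E → E := fun x => x - (μ / k ^ 2) • (T x - b)
  have hΦ : ContractingWith (√ρ).toNNReal Φ := by
    refine ⟨Real.toNNReal_lt_one.2 hρ1, LipschitzWith.of_dist_le' fun x y => ?_⟩
    have hTxy : ‖T x - T y‖ ≤ k * ‖x - y‖ := by
      rw [← dist_eq_norm, ← dist_eq_norm]
      exact (hT.dist_le_mul x y).trans (by gcongr; exact le_max_left _ _)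
    have hΦxy : Φ x - Φ y = (x - y) - (μ / k ^ 2) • (T x - T y) := by
      simp only [Φ, smul_sub]; abel
    rw [dist_eq_norm, dist_eq_norm, hΦxy]
    refine le_of_sq_le_sq ?_ (by positivity)
    rw [mul_pow, Real.sq_sqrt hρ0]
    exact norm_sub_smul_sq_le hk hμ.le hTxy (hmono x y)
  have hfix : (μ / k ^ 2) • (T hΦ.fixedPoint - b) = 0 := sub_eq_self.1 hΦ.fixedPoint_isFixedPt
  have hne : μ / k ^ 2 ≠ 0 := by positivity
  exact ⟨hΦ.fixedPoint, sub_eq_zero.1 ((smul_eq_zero.1 hfix).resolve_left hne)⟩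

end Zarantonello

/-- Edge weights of an undirected network: `W i j = 0` encodes the absence of an edge. -/
structure IsConductance {V : Type*} (W : V → V → ℝ) : Prop where
  symm : ∀ i j, W j i = W i j
  nonneg : ∀ i j, 0 ≤ W i j

/-- A family of edge responses (the current through an edge as a function of the potential drop):
antisymmetric in the orientation of the edge, vanishing at `0`, with all slopes between `c`
and `1`. -/
structure IsLink {V : Type*} (c : ℝ) (g : V → V → ℝ → ℝ) : Prop where
  antisymm : ∀ i j t, g j i (-t) = -g i j t
  map_zero : ∀ i j, g i j 0 = 0
  le_slope : ∀ i j s t, s ≤ t → c * (t - s) ≤ g i j t - g i j s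
  slope_le : ∀ i j s t, s ≤ t → g i j t - g i j s ≤ t - s

namespace IsLink

variable {V : Type*} {c : ℝ} {g : V → V → ℝ → ℝ}

lemma antisymm_drop (hg : IsLink c g) (x : V → ℝ) (i j : V) :
    g j i (x j - x i) = -g i j (x i - x j) := by
  rw [← neg_sub, hg.antisymm]

lemma mul_sq_le (hg : IsLink c g) (i j : V) (s t : ℝ) :
    c * (s - t) ^ 2 ≤ (g i j s - g i j t) * (s - t) := by
  rcases le_total s t with h | h
  · nlinarith [hg.le_slope i j s t h]
  · nlinarith [hg.le_slope i j t s h]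

lemma abs_sub_le (hg : IsLink c g) (hc : 0 ≤ c) (i j : V) (s t : ℝ) :
    |g i j s - g i j t| ≤ |s - t| := by
  wlog h : s ≤ t generalizing s t
  · rw [abs_sub_comm, abs_sub_comm s]
    exact this t s (le_of_not_ge h)
  have hmono : 0 ≤ g i j t - g i j s :=
    (mul_nonneg hc (sub_nonneg.2 h)).trans (hg.le_slope i j s t h)
  rw [abs_sub_comm, abs_of_nonneg hmono, abs_sub_comm, abs_of_nonneg (sub_nonneg.2 h)]
  exact hg.slope_le i j s t h

lemma abs_le (hg : IsLink c g) (hc : 0 ≤ c) (i j : V) (s : ℝ) : |g i j s| ≤ |s| := by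
  simpa only [hg.map_zero, sub_zero] using hg.abs_sub_le hc i j s 0

end IsLink

section Potential

variable {V : Type*} [Fintype V]

/-- The divergence of a vector field `f` on the oriented edges of a network. -/
def divergence (W f : V → V → ℝ) (i : V) : ℝ := ∑ j, W i j * f i j

/-- The net current out of each vertex of a network with responses `g` and potential `x`. -/
def flow (W : V → V → ℝ) (g : V → V → ℝ → ℝ) (x : V → ℝ) : V → ℝ :=
  divergence W fun i j => g i j (x i - x j)

/-- The Dirichlet energy, each edge counted in both orientations. -/
def energy (W : V → V → ℝ) (x : V → ℝ) : ℝ := ∑ i, ∑ j, W i j * (x i - x j) ^ 2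

/-- The functions supported on `U` whose values sum to zero. -/
def centeredOn (U : Set V) : Submodule ℝ (V → ℝ) where
  carrier := {x | (∀ i ∉ U, x i = 0) ∧ ∑ i, x i = 0}
  zero_mem' := by simp
  add_mem' := fun {x y} ⟨hx, hx'⟩ ⟨hy, hy'⟩ =>
    ⟨fun i hi => by simp [hx i hi, hy i hi], by simp [sum_add_distrib, hx', hy']⟩
  smul_mem' := fun a x ⟨hx, hx'⟩ =>
    ⟨fun i hi => by simp [hx i hi], by simp [← mul_sum, hx']⟩

/-- The Poincaré inequality with constant `lam` for centered functions supported on `U`; for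
`U = univ` it says that the spectral gap of the network is at least `lam / 2`. -/
def HasPoincare (U : Set V) (W : V → V → ℝ) (lam : ℝ) : Prop :=
  ∀ x ∈ centeredOn U, lam * ∑ i, x i ^ 2 ≤ energy W x

/-- `x` is a centered potential supported on `U` which balances the driving field `ε`: the current
that it induces has the same divergence as `ε`. -/
def IsPotential (U : Set V) (W : V → V → ℝ) (g : V → V → ℝ → ℝ) (ε : V → V → ℝ) (x : V → ℝ) :
    Prop :=
  x ∈ centeredOn U ∧ flow W g x = divergence W ε

variable {W : V → V → ℝ}

lemma IsConductance.energy_nonneg (hW : IsConductance W) (x : V → ℝ) : 0 ≤ energy W x :=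
  sum_nonneg fun i _ => sum_nonneg fun j _ => mul_nonneg (hW.nonneg i j) (sq_nonneg _)

lemma HasPoincare.eq_zero_of_energy {U : Set V} {lam : ℝ} (hP : HasPoincare U W lam)
    (hlam : 0 < lam) {x : V → ℝ} (hx : x ∈ centeredOn U) (henergy : energy W x = 0) : x = 0 := by
  have hpoincare := hP x hx
  rw [henergy] at hpoincare
  have hsq : ∑ i, x i ^ 2 = 0 := le_antisymm (nonpos_of_mul_nonpos_right hpoincare hlam)
    (sum_nonneg fun i _ => sq_nonneg _)
  rw [sum_eq_zero_iff_of_nonneg fun i _ => sq_nonneg _] at hsq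
  funext i
  exact pow_eq_zero_iff two_ne_zero |>.1 (hsq i (mem_univ i))

lemma divergence_sub (W f h : V → V → ℝ) :
    divergence W (f - h) = divergence W f - divergence W h := by
  funext i
  simp only [divergence, Pi.sub_apply, mul_sub, sum_sub_distrib]

lemma divergence_eq_zero_of_row {i : V} (hi : ∀ j, W i j = 0) (f : V → V → ℝ) :
    divergence W f i = 0 :=
  sum_eq_zero fun j _ => by rw [hi j, zero_mul]

lemma two_mul_sum_mul_divergence (hW : ∀ i j, W j i = W i j) {f : V → V → ℝ}
    (hf : ∀ i j, f j i = -f i j) (u : V → ℝ) :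
    2 * ∑ i, u i * divergence W f i = ∑ i, ∑ j, W i j * f i j * (u i - u j) := by
  have hswap : ∑ i, ∑ j, W i j * f i j * u j = -∑ i, ∑ j, W i j * f i j * u i := by
    rw [sum_comm, ← sum_neg_distrib]
    refine sum_congr rfl fun i _ => ?_
    rw [← sum_neg_distrib]
    exact sum_congr rfl fun j _ => by rw [hW, hf]; ring
  have hdiv : ∑ i, u i * divergence W f i = ∑ i, ∑ j, W i j * f i j * u i :=
    sum_congr rfl fun i _ => by rw [divergence, mul_sum]; exact sum_congr rfl fun j _ => by ring
  simp only [mul_sub, sum_sub_distrib]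
  rw [hswap, hdiv]
  ring

lemma sum_divergence (hW : ∀ i j, W j i = W i j) {f : V → V → ℝ} (hf : ∀ i j, f j i = -f i j) :
    ∑ i, divergence W f i = 0 := by
  simpa using two_mul_sum_mul_divergence hW hf fun _ => 1

lemma divergence_mem_centeredOn (hW : ∀ i j, W j i = W i j) {f : V → V → ℝ}
    (hf : ∀ i j, f j i = -f i j) {U : Set V} (hU : ∀ i ∉ U, ∀ j, W i j = 0) :
    divergence W f ∈ centeredOn U :=
  ⟨fun i hi => divergence_eq_zero_of_row (hU i hi) f, sum_divergence hW hf⟩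

namespace IsLink

variable {c : ℝ} {g : V → V → ℝ → ℝ}

lemma flow_zero (hg : IsLink c g) (W : V → V → ℝ) : flow W g 0 = 0 := by
  funext i
  simp [flow, divergence, hg.map_zero]

lemma mul_energy_le (hg : IsLink c g) (hW : IsConductance W) (x y : V → ℝ) :
    c * energy W (x - y) ≤ 2 * ∑ i, (x i - y i) * (flow W g x i - flow W g y i) := by
  have hsub : ∀ i, flow W g x i - flow W g y i
      = divergence W (fun i j => g i j (x i - x j) - g i j (y i - y j)) i := fun i =>
    (congrFun (divergence_sub W (fun i j => g i j (x i - x j)) fun i j => g i j (y i - y j)) i).symm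
  simp only [hsub]
  rw [two_mul_sum_mul_divergence hW.symm fun i j => by
    rw [hg.antisymm_drop x, hg.antisymm_drop y]; ring, energy, mul_sum]
  refine sum_le_sum fun i _ => ?_
  rw [mul_sum]
  refine sum_le_sum fun j _ => ?_
  have hdrop : (x - y) i - (x - y) j = x i - x j - (y i - y j) := by
    simp only [Pi.sub_apply]; ring
  calc c * (W i j * ((x - y) i - (x - y) j) ^ 2)
      = W i j * (c * (x i - x j - (y i - y j)) ^ 2) := by rw [hdrop]; ring
    _ ≤ W i j * ((g i j (x i - x j) - g i j (y i - y j)) * (x i - x j - (y i - y j))) :=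
        mul_le_mul_of_nonneg_left (hg.mul_sq_le _ _ _ _) (hW.nonneg i j)
    _ = _ := by ring

lemma abs_flow_sub_le (hg : IsLink c g) (hc : 0 ≤ c) (hW : ∀ i j, 0 ≤ W i j) (x y : V → ℝ)
    (i : V) : |flow W g x i - flow W g y i| ≤ (∑ j, W i j) * (2 * dist x y) := by
  have hxy : ∀ k, |x k - y k| ≤ dist x y := dist_le_pi_dist x y
  rw [flow, flow, divergence, divergence, ← sum_sub_distrib, sum_mul]
  refine (abs_sum_le_sum_abs _ _).trans (sum_le_sum fun j _ => ?_)
  rw [← mul_sub, abs_mul, abs_of_nonneg (hW i j)]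
  refine mul_le_mul_of_nonneg_left ((hg.abs_sub_le hc _ _ _ _).trans ?_) (hW i j)
  rw [sub_sub_sub_comm]
  linarith [abs_sub (x i - y i) (x j - y j), hxy i, hxy j]

lemma exists_lipschitzWith_flow (hg : IsLink c g) (hc : 0 ≤ c) (hW : ∀ i j, 0 ≤ W i j) :
    ∃ K, LipschitzWith K (flow W g) := by
  have hdeg : ∀ i, 0 ≤ ∑ j, W i j := fun i => sum_nonneg fun j _ => hW i j
  refine ⟨(2 * ∑ i, ∑ j, W i j).toNNReal, LipschitzWith.of_dist_le' fun x y => ?_⟩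
  have hsum : 0 ≤ ∑ i, ∑ j, W i j := sum_nonneg fun i _ => hdeg i
  refine (dist_pi_le_iff (by positivity)).2 fun i => ?_
  calc dist (flow W g x i) (flow W g y i) ≤ (∑ j, W i j) * (2 * dist x y) :=
        hg.abs_flow_sub_le hc hW x y i
    _ ≤ (∑ i, ∑ j, W i j) * (2 * dist x y) :=
        mul_le_mul_of_nonneg_right (single_le_sum (fun i _ => hdeg i) (mem_univ i)) (by positivity)
    _ = 2 * (∑ i, ∑ j, W i j) * dist x y := by ring

/-- On the centered functions the flow is strongly monotone, by the Poincaré inequality. -/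
theorem exists_isPotential (hg : IsLink c g) (hc : 0 < c) (hW : IsConductance W) {U : Set V}
    (hU : ∀ i ∉ U, ∀ j, W i j = 0) {lam : ℝ} (hlam : 0 < lam) (hP : HasPoincare U W lam)
    {ε : V → V → ℝ} (hε : ∀ i j, ε j i = -ε i j) : ∃ x, IsPotential U W g ε x := by
  let H : Submodule ℝ (EuclideanSpace ℝ V) :=
    (centeredOn U).comap (WithLp.linearEquiv 2 ℝ (V → ℝ)).toLinearMap
  let T : H → H := fun x => ⟨WithLp.toLp 2 (flow W g (WithLp.ofLp x.1)),
    divergence_mem_centeredOn hW.symm (hg.antisymm_drop _) hU⟩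
  obtain ⟨K, hK⟩ : ∃ K, LipschitzWith K T := by
    obtain ⟨K, hK⟩ := hg.exists_lipschitzWith_flow hc.le hW.nonneg
    have hcomp := (PiLp.lipschitzWith_toLp 2 fun _ : V => ℝ).comp <|
      (hK.comp (PiLp.lipschitzWith_ofLp 2 fun _ : V => ℝ)).comp (LipschitzWith.subtype_val (· ∈ H))
    exact ⟨_, hcomp⟩
  have hmono : ∀ x y : H, c * lam / 2 * ‖x - y‖ ^ 2 ≤ inner ℝ (T x - T y) (x - y) := fun x y => by
    have hnorm : ‖x - y‖ ^ 2 = ∑ i, (WithLp.ofLp x.1 - WithLp.ofLp y.1) i ^ 2 :=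
      EuclideanSpace.real_norm_sq_eq _
    have hinner : inner ℝ (T x - T y) (x - y) = ∑ i, (WithLp.ofLp x.1 i - WithLp.ofLp y.1 i) *
        (flow W g (WithLp.ofLp x.1) i - flow W g (WithLp.ofLp y.1) i) := rfl
    have hpoincare := mul_le_mul_of_nonneg_left (hP _ (x - y).2) hc.le
    have henergy := hg.mul_energy_le hW (WithLp.ofLp x.1) (WithLp.ofLp y.1)
    rw [hnorm, hinner]
    linarith! [hpoincare.trans henergy]
  obtain ⟨x, hx⟩ := surjective_of_lipschitz_of_stronglyMonotone hK (by positivity) hmono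
    ⟨WithLp.toLp 2 (divergence W ε), divergence_mem_centeredOn hW.symm hε hU⟩
  exact ⟨WithLp.ofLp x.1, x.2, congrArg (fun z : H => WithLp.ofLp z.1) hx⟩

end IsLink

end Potential

/-! ## Cheeger's inequality -/

section Level

variable {a b B : ℝ}

lemma setIntegral_indicator_Iio (ha : 0 ≤ a) (haB : a ≤ B) :
    ∫ t in Set.Ico 0 B, (Set.Iio a).indicator 1 t = a := by
  have hinter : Set.Iio a ∩ Set.Ico 0 B = Set.Ico 0 a := by
    ext t
    simp only [Set.mem_inter_iff, Set.mem_Iio, Set.mem_Ico]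
    exact ⟨fun h => ⟨h.2.1, h.1⟩, fun h => ⟨h.2, h.1, h.2.trans_le haB⟩⟩
  rw [integral_indicator_one measurableSet_Iio, measureReal_restrict_apply measurableSet_Iio,
    hinter, Real.volume_real_Ico_of_le ha, sub_zero]

lemma integrableOn_indicator_Iio (a B : ℝ) :
    IntegrableOn ((Set.Iio a).indicator (1 : ℝ → ℝ)) (Set.Ico 0 B) :=
  (integrable_const 1).indicator measurableSet_Iio

lemma setIntegral_abs_sub_indicator_Iio (ha : 0 ≤ a) (haB : a ≤ B) (hb : 0 ≤ b) (hbB : b ≤ B) :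
    ∫ t in Set.Ico 0 B, |(Set.Iio a).indicator (1 : ℝ → ℝ) t - (Set.Iio b).indicator 1 t|
      = |a - b| := by
  wlog hab : b ≤ a generalizing a b
  · rw [abs_sub_comm a, ← this hb hbB ha haB (le_of_not_ge hab)]
    simp only [abs_sub_comm]
  have hle : ∀ t, (Set.Iio b).indicator (1 : ℝ → ℝ) t ≤ (Set.Iio a).indicator 1 t :=
    Set.indicator_le_indicator_of_subset (Set.Iio_subset_Iio hab) fun _ => zero_le_one
  simp only [abs_of_nonneg (sub_nonneg.2 (hle _)), abs_of_nonneg (sub_nonneg.2 hab)]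
  rw [integral_sub (integrableOn_indicator_Iio a B) (integrableOn_indicator_Iio b B),
    setIntegral_indicator_Iio ha haB, setIntegral_indicator_Iio hb hbB]

end Level

section Cheeger

variable {V : Type*} [Fintype V]

/-- The total variation of `x` along the edges, each edge counted in both orientations. -/
def totalVariation (W : V → V → ℝ) (x : V → ℝ) : ℝ := ∑ i, ∑ j, W i j * |x i - x j|

/-- Edge expansion at least `κ`: the boundary of every set of at most half of the vertices has
weight at least `κ` times the size of the set. -/
def HasEdgeExpansion [DecidableEq V] (W : V → V → ℝ) (κ : ℝ) : Prop :=
  ∀ S : Finset V, 2 * #S ≤ Fintype.card V → κ * #S ≤ ∑ i ∈ S, ∑ j ∈ Sᶜ, W i j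

lemma exists_median [Nonempty V] (x : V → ℝ) :
    ∃ c : ℝ, 2 * #{i | c < x i} ≤ Fintype.card V ∧ 2 * #{i | x i < c} ≤ Fintype.card V := by
  classical
  obtain ⟨top, -, htop⟩ := exists_max_image univ x univ_nonempty
  have hne : ({i | 2 * #{j | x i < x j} ≤ Fintype.card V} : Finset V).Nonempty :=
    ⟨top, by simp [filter_eq_empty_iff.2 fun j hj => not_lt.2 (htop j hj)]⟩
  obtain ⟨i, hi, hmin⟩ := exists_min_image _ x hne
  refine ⟨x i, (mem_filter.1 hi).2, ?_⟩
  by_contra! hlt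
  have hbelow : ({j | x j < x i} : Finset V).Nonempty := by
    rw [← card_pos]; omega
  obtain ⟨j, hj, hmax⟩ := exists_max_image _ x hbelow
  have hji : x j < x i := (mem_filter.1 hj).2
  have habove : Fintype.card V < 2 * #{k | x j < x k} := by
    by_contra! h
    exact absurd (hmin j (mem_filter.2 ⟨mem_univ _, h⟩)) hji.not_ge
  have hdisj : Disjoint ({k | x k < x i} : Finset V) ({k | x j < x k} : Finset V) :=
    disjoint_left.2 fun k hk hk' => absurd (hmax k hk) (mem_filter.1 hk').2.not_ge
  have hcard := card_union_of_disjoint hdisj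
  have hle := card_le_univ (({k | x k < x i} : Finset V) ∪ ({k | x j < x k} : Finset V))
  omega

variable {W : V → V → ℝ} {κ D : ℝ}

lemma totalVariation_eq_setIntegral (W : V → V → ℝ) {a : V → ℝ} {B : ℝ} (ha : ∀ i, 0 ≤ a i)
    (haB : ∀ i, a i ≤ B) :
    totalVariation W a
      = ∫ t in Set.Ico 0 B, totalVariation W fun i => (Set.Iio (a i)).indicator 1 t := by
  have hint : ∀ i j, IntegrableOn (fun t => W i j *
      |(Set.Iio (a i)).indicator (1 : ℝ → ℝ) t - (Set.Iio (a j)).indicator 1 t|) (Set.Ico 0 B) :=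
    fun i j => ((integrableOn_indicator_Iio (a i) B).sub
      (integrableOn_indicator_Iio (a j) B)).abs.const_mul _
  simp only [totalVariation]
  rw [integral_finsetSum _ fun i _ => integrable_finsetSum _ fun j _ => hint i j]
  refine sum_congr rfl fun i _ => ?_
  rw [integral_finsetSum _ fun j _ => hint i j]
  exact sum_congr rfl fun j _ => by
    rw [integral_const_mul,
      setIntegral_abs_sub_indicator_Iio (ha i) (haB i) (ha j) (haB j)]

section Expansion

variable [DecidableEq V]

lemma totalVariation_indicator (hW : ∀ i j, W j i = W i j) (S : Finset V) :
    totalVariation W (fun i => if i ∈ S then 1 else 0) = 2 * ∑ i ∈ S, ∑ j ∈ Sᶜ, W i j := by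
  have hterm : ∀ i j, W i j * |(if i ∈ S then 1 else 0) - (if j ∈ S then 1 else 0 : ℝ)|
      = (if i ∈ S then if j ∈ Sᶜ then W i j else 0 else 0)
        + (if j ∈ S then if i ∈ Sᶜ then W j i else 0 else 0) := fun i j => by
    by_cases hi : i ∈ S <;> by_cases hj : j ∈ S <;> simp [hi, hj, hW]
  simp only [totalVariation, hterm, sum_add_distrib]
  rw [sum_comm (f := fun i j => if j ∈ S then if i ∈ Sᶜ then W j i else 0 else 0), ← two_mul]
  simp only [sum_ite_irrel, sum_ite_mem, univ_inter, sum_const_zero]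

/-- The co-area inequality, by integrating the expansion of the superlevel sets of `a`. -/
lemma two_mul_sum_le_totalVariation (hW : ∀ i j, W j i = W i j) (hexp : HasEdgeExpansion W κ)
    {a : V → ℝ} (ha : ∀ i, 0 ≤ a i) (hsupp : 2 * #{i | 0 < a i} ≤ Fintype.card V) :
    2 * κ * ∑ i, a i ≤ totalVariation W a := by
  have haB : ∀ i, a i ≤ ∑ i, a i := fun i => single_le_sum (fun i _ => ha i) (mem_univ i)
  have hlevel : ∀ t, 0 ≤ t → 2 * κ * ∑ i, (Set.Iio (a i)).indicator 1 t
      ≤ totalVariation W fun i => (Set.Iio (a i)).indicator 1 t := fun t ht => by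
    have hind : ∀ i, (Set.Iio (a i)).indicator (1 : ℝ → ℝ) t
        = if i ∈ ({i | t < a i} : Finset V) then 1 else 0 := fun i => by
      simp [Set.indicator_apply]
    simp only [hind]
    rw [totalVariation_indicator hW, sum_ite_mem, univ_inter, sum_const, nsmul_eq_mul, mul_one,
      mul_assoc]
    refine mul_le_mul_of_nonneg_left (hexp _ (le_trans ?_ hsupp)) zero_le_two
    gcongr
  have hint : ∀ i, IntegrableOn ((Set.Iio (a i)).indicator (1 : ℝ → ℝ)) (Set.Ico 0 (∑ i, a i)) :=
    fun i => integrableOn_indicator_Iio _ _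
  calc 2 * κ * ∑ i, a i
      = ∫ t in Set.Ico 0 (∑ i, a i), 2 * κ * ∑ i, (Set.Iio (a i)).indicator 1 t := by
        rw [integral_const_mul, integral_finsetSum _ fun i _ => hint i]
        simp only [setIntegral_indicator_Iio (ha _) (haB _)]
    _ ≤ ∫ t in Set.Ico 0 (∑ i, a i), totalVariation W fun i => (Set.Iio (a i)).indicator 1 t :=
        setIntegral_mono_on ((integrable_finsetSum _ fun i _ => hint i).const_mul _)
          (integrable_finsetSum _ fun i _ => integrable_finsetSum _ fun j _ =>
            ((hint i).sub (hint j)).abs.const_mul _) measurableSet_Ico fun t ht => hlevel t ht.1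
    _ = totalVariation W a := (totalVariation_eq_setIntegral W ha haB).symm

end Expansion

lemma sum_sum_mul_add_sq_le (hW : IsConductance W) (hdeg : ∀ i, ∑ j, W i j ≤ D) (x : V → ℝ) :
    ∑ i, ∑ j, W i j * (x i + x j) ^ 2 ≤ 4 * D * ∑ i, x i ^ 2 := by
  have hrow : ∑ i, ∑ j, W i j * x i ^ 2 ≤ D * ∑ i, x i ^ 2 := by
    rw [mul_sum]
    refine sum_le_sum fun i _ => ?_
    rw [← sum_mul]
    exact mul_le_mul_of_nonneg_right (hdeg i) (sq_nonneg _)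
  have hcol : ∑ i, ∑ j, W i j * x j ^ 2 = ∑ i, ∑ j, W i j * x i ^ 2 := by
    rw [sum_comm]
    simp only [hW.symm]
  calc ∑ i, ∑ j, W i j * (x i + x j) ^ 2
      ≤ ∑ i, ∑ j, (2 * (W i j * x i ^ 2) + 2 * (W i j * x j ^ 2)) :=
        sum_le_sum fun i _ => sum_le_sum fun j _ => by
          nlinarith [mul_nonneg (hW.nonneg i j) (sq_nonneg (x i - x j))]
    _ = 4 * ∑ i, ∑ j, W i j * x i ^ 2 := by
        simp only [sum_add_distrib, ← mul_sum, hcol]; ring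
    _ ≤ 4 * D * ∑ i, x i ^ 2 := by linarith

lemma sq_totalVariation_sq_le (hW : IsConductance W) (hdeg : ∀ i, ∑ j, W i j ≤ D) (x : V → ℝ) :
    totalVariation W (fun i => x i ^ 2) ^ 2 ≤ energy W x * (4 * D * ∑ i, x i ^ 2) := by
  have hCS : totalVariation W (fun i => x i ^ 2) ^ 2
      ≤ energy W x * ∑ i, ∑ j, W i j * (x i + x j) ^ 2 := by
    simp only [totalVariation, energy, ← sum_product']
    exact sum_sq_le_sum_mul_sum_of_sq_le_mul _
      (fun q _ => mul_nonneg (hW.nonneg _ _) (sq_nonneg _))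
      (fun q _ => mul_nonneg (hW.nonneg _ _) (sq_nonneg _))
      (fun q _ => le_of_eq (by rw [mul_pow, sq_abs]; ring))
  exact hCS.trans
    (mul_le_mul_of_nonneg_left (sum_sum_mul_add_sq_le hW hdeg x) (hW.energy_nonneg x))

lemma energy_max_sub_add_energy_max_sub_le (hW : IsConductance W) (x : V → ℝ) (c : ℝ) :
    energy W (fun i => max (x i - c) 0) + energy W (fun i => max (c - x i) 0) ≤ energy W x := by
  have hterm : ∀ s t : ℝ, (max (s - c) 0 - max (t - c) 0) ^ 2
      + (max (c - s) 0 - max (c - t) 0) ^ 2 ≤ (s - t) ^ 2 := fun s t => by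
    rcases le_total s c with hs | hs <;> rcases le_total t c with ht | ht <;>
      simp only [max_eq_left, max_eq_right, sub_nonneg, sub_nonpos, hs, ht] <;>
      nlinarith [mul_nonneg (sub_nonneg.2 hs) (sub_nonneg.2 ht)]
  simp only [energy, ← sum_add_distrib, ← mul_add]
  exact sum_le_sum fun i _ => sum_le_sum fun j _ =>
    mul_le_mul_of_nonneg_left (hterm _ _) (hW.nonneg i j)

lemma sum_sq_le_sum_max_sub_sq_add {x : V → ℝ} (hx : ∑ i, x i = 0) (c : ℝ) :
    ∑ i, x i ^ 2 ≤ ∑ i, max (x i - c) 0 ^ 2 + ∑ i, max (c - x i) 0 ^ 2 := by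
  have hterm : ∀ i, max (x i - c) 0 ^ 2 + max (c - x i) 0 ^ 2
      = x i ^ 2 - 2 * c * x i + c ^ 2 := fun i => by
    rcases le_total (x i) c with h | h <;>
      simp only [max_eq_left, max_eq_right, sub_nonneg, sub_nonpos, h] <;> ring
  simp only [← sum_add_distrib, hterm]
  rw [sum_add_distrib, sum_sub_distrib, ← mul_sum, hx]
  have hc : 0 ≤ ∑ _i : V, c ^ 2 := sum_nonneg fun _ _ => sq_nonneg c
  linarith

variable [DecidableEq V]

lemma HasEdgeExpansion.sq_mul_sum_sq_le_of_nonneg (hexp : HasEdgeExpansion W κ)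
    (hW : IsConductance W) (hκ : 0 ≤ κ) (hD : 0 ≤ D) (hdeg : ∀ i, ∑ j, W i j ≤ D) {x : V → ℝ}
    (hx : ∀ i, 0 ≤ x i) (hsupp : 2 * #{i | 0 < x i} ≤ Fintype.card V) :
    κ ^ 2 * ∑ i, x i ^ 2 ≤ D * energy W x := by
  have hE := hW.energy_nonneg x
  have hsupp' : 2 * #{i | 0 < x i ^ 2} ≤ Fintype.card V := by
    simpa only [pow_pos_iff two_ne_zero, (hx _).lt_iff_ne', sq_pos_iff] using hsupp
  have hcoarea := two_mul_sum_le_totalVariation hW.symm hexp (fun i => sq_nonneg (x i)) hsupp'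
  have hA : 0 ≤ ∑ i, x i ^ 2 := sum_nonneg fun i _ => sq_nonneg _
  have hsq : (2 * κ * ∑ i, x i ^ 2) ^ 2 ≤ energy W x * (4 * D * ∑ i, x i ^ 2) :=
    (pow_le_pow_left₀ (by positivity) hcoarea 2).trans (sq_totalVariation_sq_le hW hdeg x)
  rcases hA.eq_or_lt with hA | hA
  · rw [← hA, mul_zero]
    positivity
  · refine le_of_mul_le_mul_left ?_ (by positivity : 0 < 4 * ∑ i, x i ^ 2)
    linarith

theorem HasEdgeExpansion.hasPoincare (hexp : HasEdgeExpansion W κ) (hW : IsConductance W)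
    (hκ : 0 ≤ κ) (hD : 0 < D) (hdeg : ∀ i, ∑ j, W i j ≤ D) :
    HasPoincare Set.univ W (κ ^ 2 / D) := by
  rintro x ⟨-, hx⟩
  rcases isEmpty_or_nonempty V with hV | hV
  · simp [energy]
  obtain ⟨c, habove, hbelow⟩ := exists_median x
  have hpos := hexp.sq_mul_sum_sq_le_of_nonneg hW hκ hD.le hdeg
    (x := fun i => max (x i - c) 0) (fun i => le_max_right _ _) (by simpa using habove)
  have hneg := hexp.sq_mul_sum_sq_le_of_nonneg hW hκ hD.le hdeg
    (x := fun i => max (c - x i) 0) (fun i => le_max_right _ _) (by simpa using hbelow)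
  rw [div_mul_eq_mul_div, div_le_iff₀' hD]
  calc κ ^ 2 * ∑ i, x i ^ 2
      ≤ κ ^ 2 * (∑ i, max (x i - c) 0 ^ 2 + ∑ i, max (c - x i) 0 ^ 2) :=
        mul_le_mul_of_nonneg_left (sum_sq_le_sum_max_sub_sq_add hx c) (sq_nonneg _)
    _ ≤ D * (energy W (fun i => max (x i - c) 0) + energy W (fun i => max (c - x i) 0)) := by
        linarith
    _ ≤ D * energy W x :=
        mul_le_mul_of_nonneg_left (energy_max_sub_add_energy_max_sub_le hW x c) hD.le

end Cheeger

/-! ## Leave-one-out stability on expanders -/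

section Isolate

variable {V : Type*} [DecidableEq V] {W : V → V → ℝ} {m : V}

/-- The network `W` with all edges at the vertex `m` removed. -/
def isolate (W : V → V → ℝ) (m i j : V) : ℝ := if i = m ∨ j = m then 0 else W i j

lemma isolate_self (W : V → V → ℝ) (m j : V) : isolate W m m j = 0 := if_pos (Or.inl rfl)

lemma isolate_of_ne {i j : V} (hi : i ≠ m) (hj : j ≠ m) : isolate W m i j = W i j :=
  if_neg (not_or.2 ⟨hi, hj⟩)

lemma IsConductance.isolate (hW : IsConductance W) (m : V) : IsConductance (isolate W m) where
  symm i j := by simp only [BTL.isolate, hW.symm i j, or_comm]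
  nonneg i j := by unfold BTL.isolate; split_ifs; exacts [le_rfl, hW.nonneg i j]

variable [Fintype V]

lemma divergence_isolate_self (W f : V → V → ℝ) (m : V) : divergence (isolate W m) f m = 0 :=
  divergence_eq_zero_of_row (isolate_self W m) f

lemma divergence_isolate {i : V} (hi : i ≠ m) (W f : V → V → ℝ) :
    divergence (isolate W m) f i = divergence W f i - W i m * f i m := by
  have hterm : ∀ j, isolate W m i j * f i j = W i j * f i j - if j = m then W i j * f i j else 0 :=
    fun j => by by_cases hj : j = m <;> simp [isolate, hi, hj]
  simp only [divergence, hterm, sum_sub_distrib, sum_ite_eq', mem_univ, if_true]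

lemma energy_le_energy_isolate_add (hW1 : ∀ i j, W i j ≤ 1) {x : V → ℝ}
    (hx : x m = 0) : energy W x ≤ energy (isolate W m) x + 2 * ∑ i, x i ^ 2 := by
  have hterm : ∀ i j, W i j * (x i - x j) ^ 2 ≤ isolate W m i j * (x i - x j) ^ 2
      + ((if i = m then x j ^ 2 else 0) + (if j = m then x i ^ 2 else 0)) := fun i j => by
    have hle := mul_le_of_le_one_left (sq_nonneg (x i - x j)) (hW1 i j)
    rcases eq_or_ne i m with rfl | hi <;> rcases eq_or_ne j i with rfl | hji
    · simp [hx]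
    · simpa [isolate_self, hx, hji] using hle
    · simp [isolate_of_ne hi hi, hi]
    · rcases eq_or_ne j m with rfl | hj
      · simpa [isolate, hx, hi] using hle
      · simp [isolate_of_ne hi hj, hi, hj]
  calc energy W x ≤ ∑ i, ∑ j, (isolate W m i j * (x i - x j) ^ 2
        + ((if i = m then x j ^ 2 else 0) + (if j = m then x i ^ 2 else 0))) :=
        sum_le_sum fun i _ => sum_le_sum fun j _ => hterm i j
    _ = energy (isolate W m) x + 2 * ∑ i, x i ^ 2 := by
        simp only [sum_add_distrib, energy]
        rw [sum_comm (f := fun i j => if i = m then x j ^ 2 else 0)]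
        simp only [sum_ite_eq', mem_univ, if_true]
        ring

lemma HasPoincare.isolate (hW1 : ∀ i j, W i j ≤ 1) {lam : ℝ} (hP : HasPoincare Set.univ W lam)
    (m : V) : HasPoincare {m}ᶜ (isolate W m) (lam - 2) := fun x ⟨hx, hx0⟩ => by
  have henergy := energy_le_energy_isolate_add hW1 (hx m (Set.notMem_compl_iff.2 rfl))
  have hpoincare := hP x ⟨fun i hi => absurd (Set.mem_univ i) hi, hx0⟩
  linarith

end Isolate

section Stability

variable {V : Type*} [Fintype V]

lemma sq_mul_sum_sq_le {a : ℝ} (ha : 0 ≤ a) (y ζ : V → ℝ)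
    (h : a * ∑ i, y i ^ 2 ≤ 2 * ∑ i, y i * ζ i) : a ^ 2 * ∑ i, y i ^ 2 ≤ 4 * ∑ i, ζ i ^ 2 := by
  have hsq := sum_nonneg fun i (_ : i ∈ univ) => sq_nonneg (a * y i - 2 * ζ i)
  have hexpand : ∑ i, (a * y i - 2 * ζ i) ^ 2
      = a ^ 2 * ∑ i, y i ^ 2 - 4 * a * ∑ i, y i * ζ i + 4 * ∑ i, ζ i ^ 2 := by
    simp only [mul_sum, ← sum_sub_distrib, ← sum_add_distrib]
    exact sum_congr rfl fun i _ => by ring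
  nlinarith [mul_le_mul_of_nonneg_left h ha]

variable {c : ℝ} {g : V → V → ℝ → ℝ} {W : V → V → ℝ}

lemma IsLink.sq_mul_sum_sq_sub_le (hg : IsLink c g) (hc : 0 ≤ c) (hW : IsConductance W)
    {U : Set V} {lam : ℝ} (hlam : 0 ≤ lam) (hP : HasPoincare U W lam) {x y : V → ℝ}
    (hx : x ∈ centeredOn U) (hy : y ∈ centeredOn U) :
    (c * lam) ^ 2 * ∑ i, (x i - y i) ^ 2
      ≤ 4 * ∑ i, (flow W g x i - flow W g y i) ^ 2 := by
  refine sq_mul_sum_sq_le (by positivity) _ _ ?_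
  have hpoincare := mul_le_mul_of_nonneg_left (hP _ (sub_mem hx hy)) hc
  rw [← mul_assoc] at hpoincare
  exact hpoincare.trans (hg.mul_energy_le hW x y)

/-- At `i` the response to the drop `x i - x j` dominates the response to the drop `-x j` by at
least `c * |x i|` in the direction of `x i`. -/
lemma IsLink.mul_degree_mul_abs_le (hg : IsLink c g) (hc : 0 ≤ c) (hW : ∀ i j, 0 ≤ W i j)
    (x : V → ℝ) (i : V) :
    c * (∑ j, W i j) * |x i| ≤ |flow W g x i| + ∑ j, W i j * |x j| := by
  have hterm : ∀ j, c * |x i| - |x j| ≤ SignType.sign (x i) * g i j (x i - x j) := fun j => by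
    have hj := _root_.abs_le.1 (hg.abs_le hc i j (-x j))
    rw [abs_neg] at hj
    rcases lt_trichotomy 0 (x i) with h | h | h
    · rw [sign_pos h, abs_of_pos h]
      have := hg.le_slope i j (-x j) (x i - x j) (by linarith)
      simp only [SignType.coe_one, one_mul]
      linarith
    · simp [← h]
    · rw [sign_neg h, abs_of_neg h]
      have := hg.le_slope i j (x i - x j) (-x j) (by linarith)
      simp only [SignType.coe_neg, SignType.coe_one, neg_mul, one_mul]
      linarith
  have hsign : SignType.sign (x i) * flow W g x i ≤ |flow W g x i| := by
    refine (le_abs_self _).trans ?_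
    rw [abs_mul]
    refine mul_le_of_le_one_left (abs_nonneg _) ?_
    rcases lt_trichotomy 0 (x i) with h | h | h
    · simp [sign_pos h]
    · simp [← h]
    · simp [sign_neg h]
  have hsum := sum_le_sum fun j (_ : j ∈ univ) => mul_le_mul_of_nonneg_left (hterm j) (hW i j)
  have hleft : ∑ j, W i j * (c * |x i| - |x j|)
      = c * (∑ j, W i j) * |x i| - ∑ j, W i j * |x j| := by
    rw [mul_sum, sum_mul, ← sum_sub_distrib]
    exact sum_congr rfl fun j _ => by ring
  have hright : ∑ j, W i j * (SignType.sign (x i) * g i j (x i - x j))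
      = SignType.sign (x i) * flow W g x i := by
    rw [flow, divergence, mul_sum]
    exact sum_congr rfl fun j _ => by ring
  linarith

end Stability

section Recenter

variable {V : Type*} [Fintype V] [DecidableEq V] {m : V} {x : V → ℝ}

/-- The restriction to `{m}ᶜ` of a centered function, shifted by a constant so that it is centered
again. -/
def recenter (m : V) (x : V → ℝ) (i : V) : ℝ :=
  if i = m then 0 else x i + x m / (Fintype.card V - 1)

lemma recenter_mem_centeredOn (hn : 2 ≤ Fintype.card V) (m : V) (hx : ∑ i, x i = 0) :
    recenter m x ∈ centeredOn {m}ᶜ := by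
  have hn' : (Fintype.card V : ℝ) - 1 ≠ 0 := by
    have : (2 : ℝ) ≤ Fintype.card V := mod_cast hn
    linarith
  have hterm : ∀ i, recenter m x i = x i + x m / (Fintype.card V - 1)
      - if i = m then x m + x m / (Fintype.card V - 1) else 0 := fun i => by
    by_cases hi : i = m <;> simp [recenter, hi]
  refine ⟨fun i hi => if_pos (Set.notMem_compl_iff.1 hi), ?_⟩
  simp only [hterm, sum_sub_distrib, sum_add_distrib, hx, sum_const, card_univ, nsmul_eq_mul,
    sum_ite_eq', mem_univ, if_true]
  field_simp
  ring

lemma abs_sub_recenter_le (hn : 2 ≤ Fintype.card V) {i : V} (hi : i ≠ m) (x : V → ℝ) :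
    |x i - recenter m x i| ≤ 2 * |x m| / Fintype.card V := by
  have hn' : (2 : ℝ) ≤ Fintype.card V := mod_cast hn
  rw [recenter, if_neg hi, sub_add_cancel_left, abs_neg, abs_div,
    abs_of_pos (by linarith : (0 : ℝ) < Fintype.card V - 1),
    div_le_div_iff₀ (by linarith) (by linarith)]
  nlinarith [abs_nonneg (x m)]

lemma flow_isolate_recenter (W : V → V → ℝ) (g : V → V → ℝ → ℝ) (m : V) (x : V → ℝ) :
    flow (isolate W m) g (recenter m x) = flow (isolate W m) g x := by
  funext i
  refine sum_congr rfl fun j _ => ?_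
  by_cases hi : i = m
  · simp [isolate, hi]
  by_cases hj : j = m
  · simp [isolate, hj]
  simp only [recenter, hi, hj, if_false, add_sub_add_right_eq_sub]

lemma IsPotential.flow_isolate_sub {W : V → V → ℝ} {g : V → V → ℝ → ℝ} {ε : V → V → ℝ}
    {δ y : V → ℝ} {U U' : Set V} (hδ : IsPotential U W g ε δ)
    (hy : IsPotential U' (isolate W m) g ε y) (i : V) :
    flow (isolate W m) g δ i - flow (isolate W m) g y i
      = if i = m then 0 else W i m * (ε i m - g i m (δ i - δ m)) := by
  rw [hy.2]
  split_ifs with hi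
  · rw [hi, flow, divergence_isolate_self, divergence_isolate_self, sub_zero]
  · have hbal := congrFun hδ.2 i
    rw [flow] at hbal ⊢
    rw [divergence_isolate hi, divergence_isolate hi, hbal]
    ring

end Recenter

/-- A network which resembles a random graph of average degree `N`: the degrees are comparable to
`N`, and so is the spectral gap. -/
structure IsExpander {V : Type*} [Fintype V] (W : V → V → ℝ) (N : ℝ) : Prop
    extends IsConductance W where
  le_one : ∀ i j, W i j ≤ 1
  self : ∀ i, W i i = 0
  le_degree : ∀ i, N / 8 ≤ ∑ j, W i j
  degree_le : ∀ i, ∑ j, W i j ≤ 3 * N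
  hasPoincare : HasPoincare Set.univ W (N / 192)

/-- The spectral gap comes from Cheeger's inequality. -/
lemma HasEdgeExpansion.isExpander {V : Type*} [Fintype V] [DecidableEq V] {W : V → V → ℝ} {N : ℝ}
    (hexp : HasEdgeExpansion W (N / 8)) (hW : IsConductance W) (hW1 : ∀ i j, W i j ≤ 1)
    (hself : ∀ i, W i i = 0) (hdeg : ∀ i, ∑ j, W i j ≤ 3 * N) (hN : 0 < N)
    (hn : 2 ≤ Fintype.card V) : IsExpander W N where
  toIsConductance := hW
  le_one := hW1
  self := hself
  degree_le := hdeg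
  le_degree i := by
    have h := hexp {i} (by simpa using hn)
    simp only [card_singleton, Nat.cast_one, mul_one, sum_singleton] at h
    exact h.trans (sum_le_sum_of_subset_of_nonneg (subset_univ _) fun j _ _ => hW.nonneg i j)
  hasPoincare := by
    have h := hexp.hasPoincare hW (by positivity) (by positivity : 0 < 3 * N) hdeg
    have hconst : (N / 8) ^ 2 / (3 * N) = N / 192 := by field_simp; norm_num
    rwa [hconst] at h

/-- The sum of `|y|` along a row `w` is at most twice what it would be if all entries of `w` were
`p`, up to an error of `r` times the sup norm. It quantifies that `y` is not aligned with `w`. -/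
def IsTypicalRow {V : Type*} [Fintype V] (w : V → ℝ) (p r : ℝ) (y : V → ℝ) : Prop :=
  ∑ j, w j * |y j| ≤ 2 * p * ∑ j, |y j| + r * ‖y‖

lemma IsTypicalRow.mono {V : Type*} [Fintype V] {w y : V → ℝ} {p r r' : ℝ} (hr : r ≤ r')
    (h : IsTypicalRow w p r y) : IsTypicalRow w p r' y :=
  h.trans (by gcongr)

/-- The factor by which the noise of an expander with responses of slope at least `c` is amplified
in the potential. -/
def amplification (c : ℝ) : ℝ := 16 / c * (1 + 5 * (1536 / c))

namespace IsExpander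

variable {V : Type*} [Fintype V] {c N τ : ℝ} {g : V → V → ℝ → ℝ} {W ε : V → V → ℝ}
  {δ y : V → ℝ} {m : V}

lemma le_eight_mul_card_sub_one (hW : IsExpander W N) (m : V) :
    N ≤ 8 * (Fintype.card V - 1) := by
  classical
  have hcard : ∑ j, W m j ≤ Fintype.card V - 1 := by
    rw [← add_sum_erase _ _ (mem_univ m), hW.self, zero_add]
    refine (sum_le_sum fun j _ => hW.le_one m j).trans ?_
    rw [sum_const, nsmul_one, card_erase_of_mem (mem_univ m), card_univ,
      Nat.cast_sub (Fintype.card_pos_iff.2 ⟨m⟩), Nat.cast_one]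
  linarith [hW.le_degree m]

lemma two_le_card (hW : IsExpander W N) (hN : 8 ≤ N) (m : V) : 2 ≤ Fintype.card V := by
  have h := hW.le_eight_mul_card_sub_one m
  have h2 : (2 : ℝ) ≤ Fintype.card V := by linarith
  exact_mod_cast h2

lemma exists_isPotential (hW : IsExpander W N) (hN : 0 < N) (hg : IsLink c g) (hc : 0 < c)
    (hε : ∀ i j, ε j i = -ε i j) : ∃ x, IsPotential Set.univ W g ε x :=
  hg.exists_isPotential hc hW.toIsConductance (fun i hi => absurd (Set.mem_univ i) hi)
    (by positivity) hW.hasPoincare hε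

lemma sum_row_mul_abs_le (hW : IsExpander W N) (m : V) {v : V → ℝ} {r : ℝ} (hr : 0 ≤ r)
    (hv : N * ∑ i, v i ^ 2 ≤ r ^ 2) : ∑ j, W m j * |v j| ≤ 2 * r := by
  have hCS : (∑ j, W m j * |v j|) ^ 2 ≤ (∑ j, W m j) * ∑ j, v j ^ 2 :=
    sum_sq_le_sum_mul_sum_of_sq_le_mul _ (fun j _ => hW.nonneg m j) (fun j _ => sq_nonneg _)
      fun j _ => by
        rw [mul_pow, sq_abs]
        exact mul_le_mul_of_nonneg_right
          (pow_le_of_le_one (hW.nonneg m j) (hW.le_one m j) two_ne_zero) (sq_nonneg _)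
  have hdeg := mul_le_mul_of_nonneg_right (hW.degree_le m)
    (sum_nonneg fun j (_ : j ∈ univ) => sq_nonneg (v j))
  refine le_of_sq_le_sq ?_ (by positivity)
  nlinarith [sq_nonneg r]

lemma mul_abs_potential_le_add_sum_row (hW : IsExpander W N) (hg : IsLink c g) (hc : 0 ≤ c)
    (hdiv : ∀ i, |divergence W ε i| ≤ N * τ) (hδ : IsPotential Set.univ W g ε δ) :
    c * (N / 8) * |δ m| ≤ N * τ + ∑ j, W m j * |δ j| := by
  have hflow := hg.mul_degree_mul_abs_le hc hW.nonneg δ m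
  rw [hδ.2] at hflow
  have hdeg : c * (N / 8) * |δ m| ≤ c * (∑ j, W m j) * |δ m| := by
    gcongr
    exact hW.le_degree m
  linarith [hdiv m]

variable [DecidableEq V]

lemma hasPoincare_isolate (hW : IsExpander W N) (hN : 768 ≤ N) (m : V) :
    HasPoincare {m}ᶜ (isolate W m) (N / 384) := fun x hx =>
  (mul_le_mul_of_nonneg_right (by linarith) (sum_nonneg fun i _ => sq_nonneg _)).trans
    (hW.hasPoincare.isolate hW.le_one m x hx)

lemma exists_isPotential_isolate (hW : IsExpander W N) (hN : 768 ≤ N) (hg : IsLink c g)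
    (hc : 0 < c) (hε : ∀ i j, ε j i = -ε i j) (m : V) :
    ∃ x, IsPotential {m}ᶜ (isolate W m) g ε x :=
  hg.exists_isPotential hc (hW.toIsConductance.isolate m)
    (fun i hi j => by rw [Set.notMem_compl_iff.1 hi, isolate_self]) (by linarith : 0 < N / 384)
    (hW.hasPoincare_isolate hN m) hε

lemma sq_mul_sum_sq_sub_le (hW : IsExpander W N) (hN : 768 ≤ N) (hg : IsLink c g) (hc : 0 < c)
    {x y : V → ℝ} (hx : x ∈ centeredOn {m}ᶜ) (hy : y ∈ centeredOn {m}ᶜ) :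
    N ^ 2 * ∑ i, (x i - y i) ^ 2 ≤ (768 / c) ^ 2 *
      ∑ i, (flow (isolate W m) g x i - flow (isolate W m) g y i) ^ 2 := by
  have h := hg.sq_mul_sum_sq_sub_le hc.le (hW.toIsConductance.isolate m) (by linarith)
    (hW.hasPoincare_isolate hN m) hx hy
  refine le_of_mul_le_mul_left (le_of_eq_of_le ?_ (h.trans_eq ?_))
    (by positivity : 0 < (c / 384) ^ 2)
  · ring
  · field_simp
    ring

lemma abs_divergence_isolate_le (hW : IsExpander W N) (hN : 1 ≤ N) (hτ : 0 ≤ τ)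
    (hε : ∀ i j, |ε i j| ≤ √N * τ) (hdiv : ∀ i, |divergence W ε i| ≤ N * τ) (m i : V) :
    |divergence (isolate W m) ε i| ≤ 2 * (N * τ) := by
  have hNτ : 0 ≤ N * τ := (abs_nonneg _).trans (hdiv i)
  rcases eq_or_ne i m with rfl | hi
  · rw [divergence_isolate_self, abs_zero]
    exact mul_nonneg zero_le_two hNτ
  have hedge : |W i m * ε i m| ≤ N * τ :=
    calc |W i m * ε i m| = W i m * |ε i m| := by rw [abs_mul, abs_of_nonneg (hW.nonneg i m)]
      _ ≤ 1 * |ε i m| := mul_le_mul_of_nonneg_right (hW.le_one i m) (abs_nonneg _)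
      _ ≤ √N * τ := by rw [one_mul]; exact hε i m
      _ ≤ N * τ := mul_le_mul_of_nonneg_right (Real.sqrt_le_self_iff.2 (Or.inr hN)) hτ
  rw [divergence_isolate hi, two_mul]
  exact (abs_sub _ _).trans (add_le_add (hdiv i) hedge)

/-- The `ℓ¹` bound follows from the `ℓ²` bound by the Cauchy-Schwarz inequality. -/
lemma sum_abs_le (hW : IsExpander W N) (hN : 768 ≤ N) (hg : IsLink c g) (hc : 0 < c)
    (hτ : 0 ≤ τ) (hdiv : ∀ i, |divergence (isolate W m) ε i| ≤ 2 * (N * τ))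
    (hy : IsPotential {m}ᶜ (isolate W m) g ε y) :
    ∑ j, |y j| ≤ Fintype.card V * (1536 / c * τ) := by
  have hstab := hW.sq_mul_sum_sq_sub_le hN hg hc hy.1 (zero_mem _)
  simp only [hg.flow_zero, hy.2, Pi.zero_apply, sub_zero] at hstab
  have hsum : ∑ i, divergence (isolate W m) ε i ^ 2 ≤ Fintype.card V * (2 * (N * τ)) ^ 2 := by
    rw [← nsmul_eq_mul, ← card_univ]
    exact sum_le_card_nsmul _ _ _ fun i _ => sq_le_sq' (abs_le.1 (hdiv i)).1 (abs_le.1 (hdiv i)).2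
  have hℓ2 : ∑ i, y i ^ 2 ≤ Fintype.card V * (1536 / c * τ) ^ 2 := by
    refine le_of_mul_le_mul_left ?_ (by positivity : 0 < N ^ 2)
    calc N ^ 2 * ∑ i, y i ^ 2 ≤ (768 / c) ^ 2 * (Fintype.card V * (2 * (N * τ)) ^ 2) :=
          hstab.trans (mul_le_mul_of_nonneg_left hsum (sq_nonneg _))
      _ = N ^ 2 * (Fintype.card V * (1536 / c * τ) ^ 2) := by ring
  refine le_of_sq_le_sq ?_ (by positivity)
  calc (∑ j, |y j|) ^ 2 ≤ Fintype.card V * ∑ j, |y j| ^ 2 := sq_sum_le_card_mul_sum_sq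
    _ = Fintype.card V * ∑ j, y j ^ 2 := by simp only [sq_abs]
    _ ≤ Fintype.card V * (Fintype.card V * (1536 / c * τ) ^ 2) := by gcongr
    _ = (Fintype.card V * (1536 / c * τ)) ^ 2 := by ring

lemma sum_sq_flow_isolate_sub_le (hW : IsExpander W N) (hg : IsLink c g) (hc : 0 ≤ c)
    (hε : ∀ i j, |ε i j| ≤ √N * τ) (hδ : IsPotential Set.univ W g ε δ)
    (hy : IsPotential {m}ᶜ (isolate W m) g ε y) :
    ∑ i, (flow (isolate W m) g δ i - flow (isolate W m) g y i) ^ 2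
      ≤ 3 * N * (√N * τ + 2 * ‖δ‖) ^ 2 := by
  have hdrop : ∀ i, |ε i m - g i m (δ i - δ m)| ≤ √N * τ + 2 * ‖δ‖ := fun i => by
    have hδi := norm_le_pi_norm δ i
    have hδm := norm_le_pi_norm δ m
    rw [Real.norm_eq_abs] at hδi hδm
    linarith [abs_sub (ε i m) (g i m (δ i - δ m)), hg.abs_le hc i m (δ i - δ m),
      abs_sub (δ i) (δ m), hε i m]
  have hterm : ∀ i, (flow (isolate W m) g δ i - flow (isolate W m) g y i) ^ 2
      ≤ W m i * (√N * τ + 2 * ‖δ‖) ^ 2 := fun i => by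
    rw [hδ.flow_isolate_sub hy]
    split_ifs
    · simpa using mul_nonneg (hW.nonneg m i) (sq_nonneg _)
    · rw [hW.symm m i, mul_pow]
      exact mul_le_mul (pow_le_of_le_one (hW.nonneg m i) (hW.le_one m i) two_ne_zero)
        (sq_le_sq' (abs_le.1 (hdrop i)).1 (abs_le.1 (hdrop i)).2) (sq_nonneg _) (hW.nonneg m i)
  refine (sum_le_sum fun i _ => hterm i).trans ?_
  rw [← sum_mul]
  exact mul_le_mul_of_nonneg_right (hW.degree_le m) (sq_nonneg _)

/-- Shifting by a constant does not change the flow, so both `δ` and `y` balance `ε` on the network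
without `m`, up to the current through the deleted edges. -/
lemma mul_sum_sq_recenter_sub_le (hW : IsExpander W N) (hN : 768 ≤ N) (hg : IsLink c g)
    (hc : 0 < c) (hε : ∀ i j, |ε i j| ≤ √N * τ) (hδ : IsPotential Set.univ W g ε δ)
    (hy : IsPotential {m}ᶜ (isolate W m) g ε y) :
    N * ∑ i, (recenter m δ i - y i) ^ 2 ≤ (1536 / c * (√N * τ + 2 * ‖δ‖)) ^ 2 := by
  have hstab := hW.sq_mul_sum_sq_sub_le hN hg hc
    (recenter_mem_centeredOn (hW.two_le_card (by linarith) m) m hδ.1.2) hy.1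
  rw [flow_isolate_recenter] at hstab
  refine le_of_mul_le_mul_left ?_ (by linarith : 0 < N)
  calc N * (N * ∑ i, (recenter m δ i - y i) ^ 2)
      ≤ (768 / c) ^ 2 * (3 * N * (√N * τ + 2 * ‖δ‖) ^ 2) := by
        rw [← mul_assoc, ← sq]
        exact hstab.trans (mul_le_mul_of_nonneg_left
          (hW.sum_sq_flow_isolate_sub_le hg hc.le hε hδ hy) (sq_nonneg _))
    _ = 3 / 4 * (N * (1536 / c * (√N * τ + 2 * ‖δ‖)) ^ 2) := by ring
    _ ≤ N * (1536 / c * (√N * τ + 2 * ‖δ‖)) ^ 2 := by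
        have : 0 ≤ N * (1536 / c * (√N * τ + 2 * ‖δ‖)) ^ 2 := by positivity
        linarith

lemma le_of_four_mul_sq_le (hc : 0 < c) (hc1 : c ≤ 1) (hN : 4 * (1536 / c) ^ 2 ≤ N) : 768 ≤ N := by
  have ha : 1536 ≤ 1536 / c := le_div_self (by norm_num) hc hc1
  nlinarith

lemma four_mul_add_le (hc : 0 < c) (hc1 : c ≤ 1) (hN : 4 * (1536 / c) ^ 2 ≤ N) :
    4 * (1536 / c) + 48 ≤ c * N / 32 := by
  have ha : 1536 ≤ 1536 / c := le_div_self (by norm_num) hc hc1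
  have hcN : c * (4 * (1536 / c) ^ 2) = 6144 * (1536 / c) := by field_simp; norm_num
  linarith [mul_le_mul_of_nonneg_left hN hc.le]

lemma abs_sub_recenter_le (hW : IsExpander W N) (hN : 8 ≤ N) {j : V} (hj : j ≠ m) (x : V → ℝ) :
    |x j - recenter m x j| ≤ ‖x‖ ∧ N * |x j - recenter m x j| ≤ 16 * ‖x‖ := by
  have hxm : |x m| ≤ ‖x‖ := norm_le_pi_norm x m
  have hn : (2 : ℝ) ≤ Fintype.card V := mod_cast hW.two_le_card hN m
  have hNn := hW.le_eight_mul_card_sub_one m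
  have hle := BTL.abs_sub_recenter_le (hW.two_le_card hN m) hj x
  rw [le_div_iff₀ (by linarith)] at hle
  have h0 := abs_nonneg (x j - recenter m x j)
  constructor <;> nlinarith

lemma norm_le_of_isPotential_isolate (hW : IsExpander W N) (hc : 0 < c) (hc1 : c ≤ 1)
    (hN : 4 * (1536 / c) ^ 2 ≤ N) (hym : y m = 0)
    (hv : N * ∑ i, (recenter m δ i - y i) ^ 2 ≤ (1536 / c * (√N * τ + 2 * ‖δ‖)) ^ 2)
    (hτ : 0 ≤ τ) : ‖y‖ ≤ 3 * ‖δ‖ + 1536 / c * τ := by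
  have hN0 := le_of_four_mul_sq_le hc hc1 hN
  have hsqrt : 2 * (1536 / c) ≤ √N := Real.le_sqrt_of_sq_le (by linarith)
  have hsqrt0 : 0 < √N := Real.sqrt_pos.2 (by linarith)
  refine (pi_norm_le_iff_of_nonneg (by positivity)).2 fun j => ?_
  rw [Real.norm_eq_abs]
  rcases eq_or_ne j m with rfl | hj
  · rw [hym, abs_zero]; positivity
  have hvj : √N * |recenter m δ j - y j| ≤ √N * (1536 / c * τ + ‖δ‖) := by
    have hsq : √N * |recenter m δ j - y j| ≤ 1536 / c * (√N * τ + 2 * ‖δ‖) := by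
      refine le_of_sq_le_sq ?_ (by positivity)
      rw [mul_pow, Real.sq_sqrt (by linarith), sq_abs]
      exact (mul_le_mul_of_nonneg_left (single_le_sum (f := fun i => (recenter m δ i - y i) ^ 2)
        (fun i _ => sq_nonneg _) (mem_univ j)) (by linarith)).trans hv
    linarith [mul_le_mul_of_nonneg_right hsqrt (norm_nonneg δ)]
  have hvj' := le_of_mul_le_mul_left hvj hsqrt0
  have hδj : |δ j| ≤ ‖δ‖ := norm_le_pi_norm δ j
  have hshift := (hW.abs_sub_recenter_le (by linarith) hj δ).1
  have hdecomp : y j = δ j - (δ j - recenter m δ j) - (recenter m δ j - y j) := by ring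
  rw [hdecomp]
  linarith [abs_sub (δ j - (δ j - recenter m δ j)) (recenter m δ j - y j),
    abs_sub (δ j) (δ j - recenter m δ j)]

lemma sum_row_mul_abs_le_of_recenter (hW : IsExpander W N) (hN : 8 ≤ N) (δ y : V → ℝ) :
    ∑ j, W m j * |δ j|
      ≤ ∑ j, W m j * |y j| + ∑ j, W m j * |recenter m δ j - y j| + 48 * ‖δ‖ := by
  have hterm : ∀ j, W m j * |δ j|
      ≤ W m j * |y j| + W m j * |recenter m δ j - y j| + W m j * (16 * ‖δ‖ / N) := fun j => by
    rcases eq_or_ne j m with rfl | hj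
    · simp [hW.self]
    rw [← mul_add, ← mul_add]
    refine mul_le_mul_of_nonneg_left ?_ (hW.nonneg m j)
    have hshift : |δ j - recenter m δ j| ≤ 16 * ‖δ‖ / N := by
      rw [le_div_iff₀' (by linarith)]
      exact (hW.abs_sub_recenter_le hN hj δ).2
    have hdecomp : δ j = y j + (recenter m δ j - y j) + (δ j - recenter m δ j) := by ring
    calc |δ j| = |y j + (recenter m δ j - y j) + (δ j - recenter m δ j)| := by rw [← hdecomp]
      _ ≤ |y j| + |recenter m δ j - y j| + |δ j - recenter m δ j| := abs_add_three _ _ _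
      _ ≤ _ := by linarith
  refine (sum_le_sum fun j _ => hterm j).trans ?_
  rw [sum_add_distrib, sum_add_distrib, ← sum_mul]
  have hshift : (∑ j, W m j) * (16 * ‖δ‖ / N) ≤ 3 * N * (16 * ‖δ‖ / N) :=
    mul_le_mul_of_nonneg_right (hW.degree_le m) (by positivity)
  have hcancel : 3 * N * (16 * ‖δ‖ / N) = 48 * ‖δ‖ := by
    have : N ≠ 0 := by linarith
    field_simp
    ring
  linarith

/-- The balance of the flow at `m`, where the row sum of the potential is controlled through the
leave-one-out potential. -/
lemma abs_potential_le (hW : IsExpander W N) (hg : IsLink c g) (hc : 0 < c) (hc1 : c ≤ 1)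
    (hN : 4 * (1536 / c) ^ 2 ≤ N) (hτ : 0 ≤ τ) (hε : ∀ i j, |ε i j| ≤ √N * τ)
    (hdiv : ∀ i, |divergence W ε i| ≤ N * τ) (hδ : IsPotential Set.univ W g ε δ)
    (hy : IsPotential {m}ᶜ (isolate W m) g ε y)
    (hrow : IsTypicalRow (W m) (N / Fintype.card V) (c * N / 96) y) :
    |δ m| ≤ (amplification c * τ + ‖δ‖) / 2 := by
  have hN0 := le_of_four_mul_sq_le hc hc1 hN
  have hcard : (0 : ℝ) < Fintype.card V := by
    have := hW.two_le_card (by linarith) m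
    positivity
  have hv := hW.mul_sum_sq_recenter_sub_le hN0 hg hc hε hδ hy
  have hvrow := hW.sum_row_mul_abs_le m (by positivity) hv
  have hysup := hW.norm_le_of_isPotential_isolate hc hc1 hN
    (hy.1.1 m (Set.notMem_compl_iff.2 rfl)) hv hτ
  have hyrow : ∑ j, W m j * |y j| ≤ 2 * N * (1536 / c * τ)
      + c * N / 96 * (3 * ‖δ‖ + 1536 / c * τ) := by
    have hℓ1 := hW.sum_abs_le hN0 hg hc hτ
      (hW.abs_divergence_isolate_le (by linarith) hτ hε hdiv m) hy
    refine hrow.trans (add_le_add ?_ (by gcongr))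
    calc 2 * (N / Fintype.card V) * ∑ j, |y j|
        ≤ 2 * (N / Fintype.card V) * (Fintype.card V * (1536 / c * τ)) := by gcongr
      _ = 2 * N * (1536 / c * τ) := by field_simp
  have hδrow := hW.sum_row_mul_abs_le_of_recenter (m := m) (by linarith) δ y
  have hbal := hW.mul_abs_potential_le_add_sum_row (m := m) hg hc.le hdiv hδ
  have hsqrt : √N * τ ≤ N * τ :=
    mul_le_mul_of_nonneg_right (Real.sqrt_le_self_iff.2 (Or.inr (by linarith))) hτ
  have hδ_coeff : (4 * (1536 / c) + 48) * ‖δ‖ ≤ c * N / 32 * ‖δ‖ :=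
    mul_le_mul_of_nonneg_right (four_mul_add_le hc hc1 hN) (norm_nonneg δ)
  have hτ_coeff : c * N / 96 * (1536 / c * τ) ≤ N * (1536 / c * τ) := by
    gcongr
    nlinarith
  have ha_sqrt := mul_le_mul_of_nonneg_left hsqrt (by positivity : 0 ≤ 1536 / c)
  have hmain : c * (N / 8) * |δ m|
      ≤ c * (N / 8) * ((amplification c * τ + ‖δ‖) / 2) :=
    calc c * (N / 8) * |δ m| ≤ N * (1 + 5 * (1536 / c)) * τ + c * N / 16 * ‖δ‖ := by linarith
      _ = c * (N / 8) * ((amplification c * τ + ‖δ‖) / 2) := by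
        rw [amplification]
        field_simp
        ring
  exact le_of_mul_le_mul_left hmain (by positivity)

theorem norm_potential_le (hW : IsExpander W N) (hg : IsLink c g) (hc : 0 < c) (hc1 : c ≤ 1)
    (hN : 4 * (1536 / c) ^ 2 ≤ N) (hτ : 0 ≤ τ) (hε : ∀ i j, |ε i j| ≤ √N * τ)
    (hdiv : ∀ i, |divergence W ε i| ≤ N * τ) (hδ : IsPotential Set.univ W g ε δ)
    (hloo : ∀ m, ∃ y, IsPotential {m}ᶜ (isolate W m) g ε y ∧
      IsTypicalRow (W m) (N / Fintype.card V) (c * N / 96) y) :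
    ‖δ‖ ≤ amplification c * τ := by
  have hamp : 0 ≤ amplification c := by unfold amplification; positivity
  have hle : ‖δ‖ ≤ (amplification c * τ + ‖δ‖) / 2 :=
    (pi_norm_le_iff_of_nonneg (by positivity)).2 fun m => by
      obtain ⟨y, hy, hrow⟩ := hloo m
      exact hW.abs_potential_le hg hc hc1 hN hτ hε hdiv hδ hy hrow
  linarith

end IsExpander

/-! ## The truncated logistic response -/

section Sigmoid

open Real

lemma exp_neg_div_four_le_sigmoid_mul {B x : ℝ} (hx : |x| ≤ B) :
    exp (-B) / 4 ≤ sigmoid x * (1 - sigmoid x) := by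
  wlog h : 0 ≤ x generalizing x
  · have hneg := this (x := -x) (by rwa [abs_neg]) (by linarith)
    rwa [sigmoid_neg, sub_sub_cancel, mul_comm] at hneg
  have hB : exp (-B) ≤ exp (-x) := exp_le_exp.2 (by linarith [le_abs_self x])
  have hx1 : exp (-x) ≤ 1 := exp_le_one_iff.2 (by linarith)
  have hx0 := exp_pos (-x)
  have hprod : sigmoid x * (1 - sigmoid x) = exp (-x) / (1 + exp (-x)) ^ 2 := by
    rw [← sigmoid_neg, ← sigmoid_mul_rexp_neg, sigmoid_def]
    field_simp
  rw [hprod, div_le_div_iff₀ (by norm_num) (by positivity)]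
  nlinarith [mul_nonneg hx0.le (sub_nonneg.2 hx1)]

lemma mul_sub_le_sigmoid_sub {B s t : ℝ} (hs : -B ≤ s) (ht : t ≤ B) (hst : s ≤ t) :
    exp (-B) / 4 * (t - s) ≤ sigmoid t - sigmoid s := by
  refine (convex_Icc (-B) B).mul_sub_le_image_sub_of_le_deriv continuous_sigmoid.continuousOn
    differentiable_sigmoid.differentiableOn (fun x hx => ?_) s ⟨hs, hst.trans ht⟩ t
    ⟨hs.trans hst, ht⟩ hst
  rw [interior_Icc] at hx
  rw [deriv_sigmoid]
  exact exp_neg_div_four_le_sigmoid_mul (abs_le.2 ⟨hx.1.le, hx.2.le⟩)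

lemma sigmoid_sub_le {s t : ℝ} (hst : s ≤ t) : sigmoid t - sigmoid s ≤ t - s := by
  have h := convex_univ.image_sub_le_mul_sub_of_deriv_le (C := 1) continuous_sigmoid.continuousOn
    differentiable_sigmoid.differentiableOn (fun x _ => by
      rw [deriv_sigmoid]
      nlinarith [sq_nonneg (sigmoid x - 1 / 2)]) s trivial t trivial hst
  rwa [one_mul] at h

lemma exp_div_exp_add_exp (a b : ℝ) : exp a / (exp a + exp b) = sigmoid (a - b) := by
  rw [sigmoid_def, neg_sub, exp_sub]
  field_simp

lemma coe_winProb {n : ℕ} (θ : Fin n → ℝ) (i j : Fin n) :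
    (winProb θ i j : ℝ) = sigmoid (θ i - θ j) := exp_div_exp_add_exp _ _

end Sigmoid

section TruncLink

/-- The projection of the real line to `[-1, 1]`. -/
def clamp (t : ℝ) : ℝ := Set.projIcc (-1 : ℝ) 1 (neg_le_self zero_le_one) t

lemma abs_clamp_le (t : ℝ) : |clamp t| ≤ 1 := abs_le.2 (Set.projIcc _ _ _ t).2

lemma clamp_of_abs_le {t : ℝ} (ht : |t| ≤ 1) : clamp t = t := by
  rw [clamp, Set.projIcc_of_mem _ (abs_le.1 ht)]

lemma clamp_mono : Monotone clamp := Set.monotone_projIcc _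

lemma clamp_sub_le {s t : ℝ} (h : s ≤ t) : clamp t - clamp s ≤ t - s :=
  (le_abs_self _).trans <|
    (Set.abs_projIcc_sub_projIcc _).trans_eq <| abs_of_nonneg (sub_nonneg.2 h)

lemma clamp_neg (t : ℝ) : clamp (-t) = -clamp t := by
  simp only [clamp, Set.coe_projIcc]
  grind

/-- The slope of the logistic function on `[-(b + 1), b + 1]` is at least `truncSlope b`. -/
def truncSlope (b : ℝ) : ℝ := Real.exp (-(b + 1)) / 4

lemma truncSlope_pos (b : ℝ) : 0 < truncSlope b := by unfold truncSlope; positivity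

lemma truncSlope_le_one {b : ℝ} (hb : 0 ≤ b) : truncSlope b ≤ 1 := by
  have := Real.exp_le_one_iff.2 (by linarith : -(b + 1) ≤ 0)
  unfold truncSlope
  linarith

variable {V : Type*}

/-- The increment of the logistic function at `θ i - θ j`, continued linearly with slope `c`
outside `[-1, 1]`, which keeps all slopes bounded below. -/
def truncLink (c : ℝ) (θ : V → ℝ) (i j : V) (t : ℝ) : ℝ :=
  Real.sigmoid (θ i - θ j + clamp t) - Real.sigmoid (θ i - θ j) + c * (t - clamp t)

lemma truncLink_of_abs_le (c : ℝ) (θ : V → ℝ) (i j : V) {t : ℝ} (ht : |t| ≤ 1) :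
    truncLink c θ i j t = Real.sigmoid (θ i - θ j + t) - Real.sigmoid (θ i - θ j) := by
  rw [truncLink, clamp_of_abs_le ht, sub_self, mul_zero, add_zero]

lemma isLink_truncLink {b : ℝ} {θ : V → ℝ} (hθ : ∀ i j, |θ i - θ j| ≤ b) :
    IsLink (truncSlope b) (truncLink (truncSlope b) θ) where
  antisymm i j t := by
    have hdrop : θ j - θ i = -(θ i - θ j) := by ring
    have hdrop' : -(θ i - θ j) + -clamp t = -(θ i - θ j + clamp t) := by ring
    rw [truncLink, truncLink, clamp_neg, hdrop, hdrop', Real.sigmoid_neg, Real.sigmoid_neg]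
    ring
  map_zero i j := by
    rw [truncLink_of_abs_le _ _ _ _ (by norm_num), add_zero, sub_self]
  le_slope i j s t h := by
    have hb := abs_le.1 (hθ i j)
    have hslope := mul_sub_le_sigmoid_sub (B := b + 1) (s := θ i - θ j + clamp s)
      (t := θ i - θ j + clamp t) (by linarith [(abs_le.1 (abs_clamp_le s)).1])
      (by linarith [(abs_le.1 (abs_clamp_le t)).2]) (by linarith [clamp_mono h])
    simp only [truncLink, truncSlope]
    linarith
  slope_le i j s t h := by
    have hslope := sigmoid_sub_le (s := θ i - θ j + clamp s) (t := θ i - θ j + clamp t)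
      (by linarith [clamp_mono h])
    have hlinear := mul_le_mul_of_nonneg_right
      (truncSlope_le_one ((abs_nonneg _).trans (hθ i i))) (sub_nonneg.2 (clamp_sub_le h))
    simp only [truncLink]
    linarith

end TruncLink

/-! ## The maximum likelihood estimate -/

section Softplus

open Real

/-- The Bregman divergence of the softplus function `t ↦ log (1 + exp t)`, whose derivative is the
logistic function. -/
def softplusGap (s t : ℝ) : ℝ := log (1 + exp t) - log (1 + exp s) - sigmoid s * (t - s)

lemma softplusGap_self (s : ℝ) : softplusGap s s = 0 := by simp [softplusGap]

/-- This is Jensen's inequality for `exp` with weights `1 - sigmoid s` at `0` and `sigmoid s` at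
`t - s`. -/
lemma softplusGap_pos {s t : ℝ} (h : t ≠ s) : 0 < softplusGap s t := by
  set q := sigmoid s with hq
  have hqs : q * (1 + exp s) = exp s := by
    rw [hq, sigmoid_def, exp_neg]
    field_simp
    ring
  have hjensen := strictConvexOn_exp.2 (Set.mem_univ 0) (Set.mem_univ (t - s))
    (sub_ne_zero.2 h).symm (sub_pos.2 (sigmoid_lt_one s)) (sigmoid_pos s) (by ring)
  simp only [smul_eq_mul, mul_zero, zero_add, exp_zero, mul_one, ← hq] at hjensen
  have hexp : (1 + exp s) * exp (q * (t - s)) < 1 + exp t :=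
    calc (1 + exp s) * exp (q * (t - s)) < (1 + exp s) * (1 - q + q * exp (t - s)) :=
          mul_lt_mul_of_pos_left hjensen (by positivity)
      _ = 1 + exp s - q * (1 + exp s) + q * (1 + exp s) * exp (t - s) := by ring
      _ = 1 + exp t := by rw [hqs, ← exp_add]; ring_nf
  have hlog := log_lt_log (by positivity) hexp
  rw [log_mul (by positivity) (by positivity), log_exp] at hlog
  rw [softplusGap, ← hq]
  linarith

lemma softplusGap_nonneg (s t : ℝ) : 0 ≤ softplusGap s t := by
  rcases eq_or_ne t s with rfl | h
  · rw [softplusGap_self]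
  · exact (softplusGap_pos h).le

lemma eq_of_softplusGap_eq_zero {s t : ℝ} (h : softplusGap s t = 0) : t = s :=
  not_ne_iff.1 fun hne => (softplusGap_pos hne).ne' h

lemma log_exp_div_exp_add_exp (a b : ℝ) :
    log (exp a / (exp a + exp b)) = a - b - log (1 + exp (a - b)) := by
  have hsum : exp a + exp b = exp b * (1 + exp (a - b)) := by
    rw [mul_add, ← exp_add]
    ring_nf
  rw [hsum, log_div (exp_pos a).ne' (by positivity), log_mul (exp_pos b).ne' (by positivity),
    log_exp, log_exp]
  ring

lemma log_exp_div_exp_add_exp' (a b : ℝ) :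
    log (exp b / (exp a + exp b)) = -log (1 + exp (a - b)) := by
  have hratio : exp b / (exp a + exp b) = (1 + exp (a - b))⁻¹ := by
    rw [exp_sub]
    field_simp
    ring
  rw [hratio, log_inv]

end Softplus

section ItemPair

variable {n : ℕ}

lemma sum_itemPair (h : Fin n → Fin n → ℝ) :
    ∑ e : ItemPair n, h e.1.1 e.1.2 = ∑ i, ∑ j, if j < i then h i j else 0 := by
  rw [← sum_product' (f := fun i j => if j < i then h i j else 0), ← sum_filter,
    ← sum_subtype (univ.filter fun q : Fin n × Fin n => q.2 < q.1) (p := fun q => q.2 < q.1)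
      (by simp) fun q => h q.1 q.2]
  rfl

lemma two_mul_sum_itemPair {h : Fin n → Fin n → ℝ} (hsymm : ∀ i j, h j i = h i j)
    (hdiag : ∀ i, h i i = 0) : 2 * ∑ e : ItemPair n, h e.1.1 e.1.2 = ∑ i, ∑ j, h i j := by
  have hlower := sum_itemPair h
  have hupper : ∑ e : ItemPair n, h e.1.1 e.1.2 = ∑ i, ∑ j, if i < j then h i j else 0 := by
    rw [hlower, sum_comm]
    exact sum_congr rfl fun i _ => sum_congr rfl fun j _ => by rw [hsymm]
  rw [two_mul]
  nth_rewrite 1 [hlower]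
  rw [hupper, ← sum_add_distrib]
  refine sum_congr rfl fun i _ => ?_
  rw [← sum_add_distrib]
  refine sum_congr rfl fun j _ => ?_
  rcases lt_trichotomy i j with hij | rfl | hij
  · simp [hij, hij.not_gt]
  · simp [hdiag]
  · simp [hij, hij.not_gt]

/-- The antisymmetric extension to all pairs of items. -/
def altExt (f : ItemPair n → ℝ) (i j : Fin n) : ℝ :=
  if h : j < i then f ⟨(i, j), h⟩ else if h : i < j then -f ⟨(j, i), h⟩ else 0

lemma altExt_antisymm (f : ItemPair n → ℝ) (i j : Fin n) : altExt f j i = -altExt f i j := by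
  rcases lt_trichotomy i j with h | rfl | h
  · simp [altExt, h, h.not_gt]
  · simp [altExt]
  · simp [altExt, h, h.not_gt]

lemma altExt_pair (f : ItemPair n → ℝ) (e : ItemPair n) : altExt f e.1.1 e.1.2 = f e := by
  simp [altExt, e.2]

lemma abs_altExt_le {f : ItemPair n → ℝ} {b : ℝ} (hb : 0 ≤ b) (hf : ∀ e, |f e| ≤ b)
    (i j : Fin n) : |altExt f i j| ≤ b := by
  unfold altExt
  split_ifs
  · exact hf _
  · rw [abs_neg]
    exact hf _
  · simpa using hb

end ItemPair

open Classical in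
/-- The comparison graph as a network with unit edge weights. -/
def edgeWeight {n : ℕ} (G : SimpleGraph (Fin n)) (i j : Fin n) : ℝ := if G.Adj i j then 1 else 0

section EdgeWeight

variable {n : ℕ} (G : SimpleGraph (Fin n)) (i j : Fin n)

lemma edgeWeight_le_one : edgeWeight G i j ≤ 1 := by
  unfold edgeWeight; split_ifs; exacts [le_rfl, zero_le_one]

lemma edgeWeight_self : edgeWeight G i i = 0 := by simp [edgeWeight]

lemma isConductance_edgeWeight : IsConductance (edgeWeight G) where
  symm i j := by by_cases h : G.Adj i j <;> simp [edgeWeight, h, G.adj_comm j i]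
  nonneg i j := by unfold edgeWeight; split_ifs; exacts [zero_le_one, le_rfl]

end EdgeWeight

section MLE

variable {n L : ℕ}

/-- The fraction of the `L` outcomes at the pair `(i, j)` in which `i` beats `j`. -/
def meanOutcome (y : ItemPair n → Fin L → Bool) (e : ItemPair n) : ℝ :=
  1 / (L : ℝ) * ∑ l, if y e l then 1 else 0

/-- The deviation of the mean outcomes from the winning probabilities for the scores `θ`. The score
equations say that its divergence on the comparison graph vanishes. -/
def noise (θ : Fin n → ℝ) (y : ItemPair n → Fin L → Bool) : Fin n → Fin n → ℝ :=
  altExt fun e => meanOutcome y e - Real.sigmoid (θ e.1.1 - θ e.1.2)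

lemma noise_antisymm (θ : Fin n → ℝ) (y : ItemPair n → Fin L → Bool) (i j : Fin n) :
    noise θ y j i = -noise θ y i j := altExt_antisymm _ i j

lemma noise_sub_noise (θ θ' : Fin n → ℝ) (y : ItemPair n → Fin L → Bool) (i j : Fin n) :
    noise θ y i j - noise θ' y i j
      = Real.sigmoid (θ' i - θ' j) - Real.sigmoid (θ i - θ j) := by
  rcases lt_trichotomy i j with h | rfl | h
  · simp only [noise, altExt, h, h.not_gt, dif_pos, dif_neg, not_false_iff]
    rw [← neg_sub (θ i), ← neg_sub (θ' i), Real.sigmoid_neg, Real.sigmoid_neg]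
    ring
  · simp [noise, altExt]
  · simp only [noise, altExt, h, dif_pos]
    ring

lemma negLogLik_observe (hL : 1 ≤ L) (ω : Sample n L) (θ : Fin n → ℝ) :
    negLogLik (observe ω) θ = ∑ e : ItemPair n, edgeWeight ω.1 e.1.1 e.1.2 *
      (Real.log (1 + Real.exp (θ e.1.1 - θ e.1.2)) - meanOutcome ω.2 e * (θ e.1.1 - θ e.1.2)) := by
  have hL' : (L : ℝ) ≠ 0 := by positivity
  rw [negLogLik, mul_sum]
  refine sum_congr rfl fun e _ => ?_
  by_cases h : ω.1.Adj e.1.1 e.1.2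
  · simp only [observe, edgeWeight, h, if_true, Option.elim_some]
    set a := θ e.1.1
    set b := θ e.1.2
    have hl : ∀ l, Real.log (if ω.2 e l then Real.exp a / (Real.exp a + Real.exp b)
        else Real.exp b / (Real.exp a + Real.exp b))
        = (if ω.2 e l then 1 else 0) * (a - b) - Real.log (1 + Real.exp (a - b)) := fun l => by
      split_ifs
      · rw [log_exp_div_exp_add_exp, one_mul]
      · rw [log_exp_div_exp_add_exp', zero_mul, zero_sub]
    rw [sum_congr rfl fun l _ => hl l, sum_sub_distrib, ← sum_mul, meanOutcome, sum_const,
      card_univ, Fintype.card_fin, nsmul_eq_mul]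
    field_simp
    ring
  · simp [observe, edgeWeight, h]

/-- The first-order term drops out of the expansion at a solution of the score equations. -/
lemma negLogLik_sub_of_divergence_noise (hL : 1 ≤ L) {ω : Sample n L} {θ : Fin n → ℝ}
    (hscore : divergence (edgeWeight ω.1) (noise θ ω.2) = 0) (θ' : Fin n → ℝ) :
    negLogLik (observe ω) θ' - negLogLik (observe ω) θ = ∑ e : ItemPair n,
      edgeWeight ω.1 e.1.1 e.1.2 * softplusGap (θ e.1.1 - θ e.1.2) (θ' e.1.1 - θ' e.1.2) := by
  have hW := isConductance_edgeWeight ω.1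
  have hparts := two_mul_sum_mul_divergence hW.symm (noise_antisymm θ ω.2) (θ' - θ)
  rw [hscore, ← two_mul_sum_itemPair (fun i j => by rw [hW.symm, noise_antisymm]; ring)
    (fun i => by rw [sub_self, mul_zero])] at hparts
  simp only [Pi.zero_apply, mul_zero, sum_const_zero] at hparts
  have hlinear : ∑ e : ItemPair n, edgeWeight ω.1 e.1.1 e.1.2 * noise θ ω.2 e.1.1 e.1.2
      * ((θ' - θ) e.1.1 - (θ' - θ) e.1.2) = 0 := by linarith
  rw [negLogLik_observe hL, negLogLik_observe hL, ← sum_sub_distrib, ← sub_eq_zero,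
    ← neg_eq_zero, ← hlinear, ← sum_sub_distrib, ← sum_neg_distrib]
  refine sum_congr rfl fun e _ => ?_
  rw [noise, altExt_pair, softplusGap, Pi.sub_apply, Pi.sub_apply]
  ring

lemma energy_eq_zero_of_softplusGap {W : Fin n → Fin n → ℝ} (hW : IsConductance W)
    {θ θ' : Fin n → ℝ} (h : ∑ e : ItemPair n,
      W e.1.1 e.1.2 * softplusGap (θ e.1.1 - θ e.1.2) (θ' e.1.1 - θ' e.1.2) = 0) :
    energy W (θ' - θ) = 0 := by
  rw [sum_eq_zero_iff_of_nonneg fun e _ =>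
    mul_nonneg (hW.nonneg _ _) (softplusGap_nonneg _ _)] at h
  rw [energy, ← two_mul_sum_itemPair (fun i j => by rw [hW.symm]; ring) (fun i => by simp),
    sum_eq_zero fun e _ => ?_, mul_zero]
  rcases mul_eq_zero.1 (h e (mem_univ e)) with h | h
  · rw [h, zero_mul]
  · have hdrop := eq_of_softplusGap_eq_zero h
    rw [Pi.sub_apply, Pi.sub_apply, sub_sub_sub_comm, hdrop, sub_self]
    ring

/-- Existence and uniqueness express the strict convexity of the negative log-likelihood on a
connected graph. -/
lemma isMLE_of_divergence_noise (hL : 1 ≤ L) {ω : Sample n L} {θ : Fin n → ℝ}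
    (hθ : ∑ i, θ i = 0) (hscore : divergence (edgeWeight ω.1) (noise θ ω.2) = 0) {lam : ℝ}
    (hlam : 0 < lam) (hP : HasPoincare Set.univ (edgeWeight ω.1) lam) :
    IsMLE (observe ω) θ ∧ ∀ θ', IsMLE (observe ω) θ' → θ' = θ := by
  have hW := isConductance_edgeWeight ω.1
  have hgap := negLogLik_sub_of_divergence_noise hL hscore
  have hgap0 : ∀ θ' : Fin n → ℝ, 0 ≤ ∑ e : ItemPair n,
      edgeWeight ω.1 e.1.1 e.1.2 * softplusGap (θ e.1.1 - θ e.1.2) (θ' e.1.1 - θ' e.1.2) :=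
    fun θ' => sum_nonneg fun e _ => mul_nonneg (hW.nonneg _ _) (softplusGap_nonneg _ _)
  refine ⟨⟨hθ, fun θ' _ => by linarith [hgap θ', hgap0 θ']⟩, fun θ' hθ' => ?_⟩
  have henergy := energy_eq_zero_of_softplusGap hW
    (le_antisymm (by linarith [hgap θ', hθ'.2 θ hθ]) (hgap0 θ'))
  refine sub_eq_zero.1 (hP.eq_zero_of_energy hlam ⟨fun i hi => absurd (Set.mem_univ i) hi, ?_⟩
    henergy)
  simp only [Pi.sub_apply, sum_sub_distrib, hθ, hθ'.1, sub_self]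

open Classical in
/-- The potential driven by the noise on a network `A` from which the item `m` has been removed,
and zero if there is none. Choosing it as a function of `A` makes it independent of the edges
at `m`. -/
def looPotential (c : ℝ) (θ : Fin n → ℝ) (y : ItemPair n → Fin L → Bool) (m : Fin n)
    (A : Fin n → Fin n → ℝ) : Fin n → ℝ :=
  if h : ∃ x, IsPotential {m}ᶜ A (truncLink c θ) (noise θ y) x then h.choose else 0

lemma isPotential_looPotential {c : ℝ} {θ : Fin n → ℝ} {y : ItemPair n → Fin L → Bool}
    {m : Fin n} {A : Fin n → Fin n → ℝ}
    (h : ∃ x, IsPotential {m}ᶜ A (truncLink c θ) (noise θ y) x) :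
    IsPotential {m}ᶜ A (truncLink c θ) (noise θ y) (looPotential c θ y m A) := by
  rw [looPotential, dif_pos h]
  exact h.choose_spec

/-- As long as the truncation is not active, adding the potential to `θ` cancels the noise. -/
lemma IsPotential.divergence_noise_add {ω : Sample n L} {c : ℝ} {θ δ : Fin n → ℝ} {U : Set (Fin n)}
    (hδ : IsPotential U (edgeWeight ω.1) (truncLink c θ) (noise θ ω.2) δ) (hδ1 : ‖δ‖ ≤ 1 / 2) :
    divergence (edgeWeight ω.1) (noise (θ + δ) ω.2) = 0 := by
  have hnoise : noise (θ + δ) ω.2 = noise θ ω.2 - fun i j => truncLink c θ i j (δ i - δ j) := by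
    funext i j
    have hdrop : |δ i - δ j| ≤ 1 := by
      have hi := norm_le_pi_norm δ i
      have hj := norm_le_pi_norm δ j
      rw [Real.norm_eq_abs] at hi hj
      linarith [abs_sub (δ i) (δ j)]
    have hsub := noise_sub_noise (θ + δ) θ ω.2 i j
    rw [Pi.add_apply, Pi.add_apply, add_sub_add_comm] at hsub
    rw [Pi.sub_apply, Pi.sub_apply, truncLink_of_abs_le _ _ _ _ hdrop]
    linarith
  have hflow := hδ.2
  rw [flow] at hflow
  rw [hnoise, divergence_sub, hflow, sub_self]

theorem exists_isMLE_of_isExpander (hL : 1 ≤ L) {ω : Sample n L} {θ : Fin n → ℝ}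
    (hθ0 : ∑ i, θ i = 0) {b : ℝ} (hb : 0 ≤ b) (hθ : ∀ i j, |θ i - θ j| ≤ b) {N τ : ℝ}
    (hW : IsExpander (edgeWeight ω.1) N) (hN : 4 * (1536 / truncSlope b) ^ 2 ≤ N) (hτ : 0 ≤ τ)
    (hsmall : amplification (truncSlope b) * τ ≤ 1 / 2)
    (hε : ∀ i j, |noise θ ω.2 i j| ≤ √N * τ)
    (hdiv : ∀ i, |divergence (edgeWeight ω.1) (noise θ ω.2) i| ≤ N * τ)
    (hrow : ∀ m, IsTypicalRow (edgeWeight ω.1 m) (N / n) (truncSlope b * N / 96)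
      (looPotential (truncSlope b) θ ω.2 m (isolate (edgeWeight ω.1) m))) :
    ∃ θhat : Fin n → ℝ, IsMLE (observe ω) θhat ∧
      (∀ θ' : Fin n → ℝ, IsMLE (observe ω) θ' → θ' = θhat) ∧
      ‖θhat - θ‖ ≤ amplification (truncSlope b) * τ := by
  have hc := truncSlope_pos b
  have hc1 := truncSlope_le_one hb
  have hN0 := IsExpander.le_of_four_mul_sq_le hc hc1 hN
  have hg := isLink_truncLink hθ
  have hanti := noise_antisymm θ ω.2
  obtain ⟨δ, hδ⟩ := hW.exists_isPotential (by linarith) hg hc hanti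
  have hδle : ‖δ‖ ≤ amplification (truncSlope b) * τ :=
    hW.norm_potential_le hg hc hc1 hN hτ hε hdiv hδ fun m =>
      ⟨_, isPotential_looPotential (hW.exists_isPotential_isolate hN0 hg hc hanti m), by
        rw [Fintype.card_fin]
        exact hrow m⟩
  obtain ⟨hmle, hunique⟩ := isMLE_of_divergence_noise hL (θ := θ + δ)
    (by simp [sum_add_distrib, hθ0, hδ.1.2]) (hδ.divergence_noise_add (hδle.trans hsmall))
    (by linarith : 0 < N / 192) hW.hasPoincare
  refine ⟨θ + δ, hmle, hunique, ?_⟩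
  rwa [add_sub_cancel_left]

end MLE

/-! ## Concentration on finite product spaces -/

section Chernoff

lemma measureReal_ge_le_of_integral_exp_le {α : Type*} [MeasurableSpace α] {μ : Measure α}
    [IsFiniteMeasure μ] {f : α → ℝ} (hf : Integrable (fun x => Real.exp (f x)) μ) {A : ℝ}
    (h : ∫ x, Real.exp (f x) ∂μ ≤ Real.exp A) (t : ℝ) :
    μ.real {x | t ≤ f x} ≤ Real.exp (A - t) := by
  have hchernoff := measure_ge_le_exp_mul_mgf (μ := μ) (X := f) t zero_le_one
    (by simpa only [one_mul] using hf)
  simp only [mgf, neg_mul, one_mul] at hchernoff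
  calc μ.real {x | t ≤ f x} ≤ Real.exp (-t) * Real.exp A :=
        hchernoff.trans (mul_le_mul_of_nonneg_left h (Real.exp_pos _).le)
    _ = Real.exp (A - t) := by rw [← Real.exp_add, neg_add_eq_sub]

lemma measureReal_union_le_add {Ω : Type*} [MeasurableSpace Ω] {μ : Measure Ω} {A B : Set Ω}
    {s t : ℝ} (hA : μ.real A ≤ s) (hB : μ.real B ≤ t) : μ.real (A ∪ B) ≤ s + t :=
  (measureReal_union_le A B).trans (add_le_add hA hB)

lemma measureReal_exists_le {ι α : Type*} [Fintype ι] [MeasurableSpace α] {μ : Measure α}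
    [IsFiniteMeasure μ] {P : ι → α → Prop} {t : ι → ℝ} (h : ∀ i, μ.real {x | P i x} ≤ t i) :
    μ.real {x | ∃ i, P i x} ≤ ∑ i, t i := by
  rw [Set.ofPred_exists]
  exact (measureReal_iUnion_fintype_le _).trans (sum_le_sum fun i _ => h i)

lemma measurePreserving_piecewise {ι : Type*} [Fintype ι] [DecidableEq ι] {α : ι → Type*}
    [∀ i, MeasurableSpace (α i)] (μ : ∀ i, Measure (α i)) [∀ i, IsProbabilityMeasure (μ i)]
    (T : Finset ι) :
    MeasurePreserving (fun z : (∀ i, α i) × (∀ i, α i) => T.piecewise z.1 z.2)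
      ((Measure.pi μ).prod (Measure.pi μ)) (Measure.pi μ) := by
  have hmeas : Measurable fun z : (∀ i, α i) × (∀ i, α i) => T.piecewise z.1 z.2 := by
    refine measurable_pi_lambda _ fun i => ?_
    by_cases hi : i ∈ T
    · simp only [piecewise_eq_of_mem _ _ _ hi]
      fun_prop
    · simp only [piecewise_eq_of_notMem _ _ _ hi]
      fun_prop
  refine ⟨hmeas, (Measure.pi_eq fun s hs => ?_).symm⟩
  have hpre : (fun z : (∀ i, α i) × (∀ i, α i) => T.piecewise z.1 z.2) ⁻¹' Set.univ.pi s
      = Set.univ.pi (T.piecewise s fun _ => Set.univ) ×ˢ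
        Set.univ.pi (T.piecewise (fun _ => Set.univ) s) := by
    ext z
    simp only [Set.mem_preimage, Set.mem_prod, Set.mem_univ_pi, ← forall_and]
    refine forall_congr' fun i => ?_
    by_cases hi : i ∈ T <;> simp [hi]
  rw [Measure.map_apply hmeas (MeasurableSet.univ_pi hs), hpre, Measure.prod_prod, Measure.pi_pi,
    Measure.pi_pi, ← prod_mul_distrib]
  refine prod_congr rfl fun i _ => ?_
  by_cases hi : i ∈ T <;> simp [hi]

end Chernoff

section Bits

variable {ι : Type*} [Fintype ι]

/-- The law of independent bits which are `true` with probability `p`. -/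
def bitLaw (ι : Type*) [Fintype ι] (p : unitInterval) : Measure (ι → Bool) :=
  Measure.pi fun _ => bernoulliMeasure true false p

instance (p : unitInterval) : IsProbabilityMeasure (bitLaw ι p) := by
  unfold bitLaw; infer_instance

lemma integral_exp_sum_bits (p : unitInterval) (T : Finset ι) (s : ι → ℝ) :
    ∫ b, Real.exp (∑ e ∈ T, if b e then s e else 0) ∂bitLaw ι p
      = ∏ e ∈ T, ((p : ℝ) * Real.exp (s e) + (1 - p)) := by
  classical
  have hprod : ∀ b : ι → Bool, Real.exp (∑ e ∈ T, if b e then s e else 0)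
      = ∏ e, if e ∈ T then Real.exp (if b e then s e else 0) else 1 := fun b => by
    rw [Real.exp_sum, prod_ite_mem, univ_inter]
  simp_rw [hprod]
  rw [bitLaw, integral_fintype_prod_eq_prod
    (fun e (b : Bool) => if e ∈ T then Real.exp (if b then s e else 0) else 1),
    ← univ_inter T, ← prod_ite_mem]
  refine prod_congr rfl fun e _ => ?_
  rw [integral_bernoulliMeasure]
  by_cases he : e ∈ T <;> simp [he]

lemma integral_exp_sum_bits_le (p : unitInterval) (T : Finset ι) (s : ι → ℝ) :
    ∫ b, Real.exp (∑ e ∈ T, if b e then s e else 0) ∂bitLaw ι p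
      ≤ Real.exp (p * ∑ e ∈ T, (Real.exp (s e) - 1)) := by
  rw [integral_exp_sum_bits, mul_sum, Real.exp_sum]
  refine prod_le_prod (fun e _ => ?_) fun e _ => ?_
  · linarith [mul_nonneg p.2.1 (Real.exp_pos (s e)).le, p.2.2]
  · linarith [Real.add_one_le_exp ((p : ℝ) * (Real.exp (s e) - 1))]

lemma exp_sub_one_le_two_mul {a : ℝ} (ha0 : 0 ≤ a) (ha1 : a ≤ 1) : Real.exp a - 1 ≤ 2 * a := by
  have h := Real.abs_exp_sub_one_le (x := a) (by rwa [abs_of_nonneg ha0])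
  rw [abs_of_nonneg ha0] at h
  exact (le_abs_self _).trans h

lemma integral_exp_weighted_bits_le_one (p : unitInterval) (T : Finset ι) {a : ι → ℝ}
    (ha0 : ∀ e, 0 ≤ a e) (ha1 : ∀ e, a e ≤ 1) :
    ∫ b, Real.exp ((∑ e ∈ T, if b e then a e else 0) - 2 * p * ∑ e ∈ T, a e) ∂bitLaw ι p
      ≤ 1 := by
  simp_rw [Real.exp_sub]
  rw [integral_div, div_le_one (Real.exp_pos _)]
  refine (integral_exp_sum_bits_le p T a).trans (Real.exp_le_exp.2 ?_)
  rw [mul_comm 2 (p : ℝ), mul_assoc, mul_sum (f := a)]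
  exact mul_le_mul_of_nonneg_left
    (sum_le_sum fun e _ => exp_sub_one_le_two_mul (ha0 e) (ha1 e)) p.2.1

/-- The weights of the bits in `T` may themselves depend on the bits off `T`. -/
lemma bitLaw_weighted_sum_ge_le (p : unitInterval) (T : Finset ι) {a : (ι → Bool) → ι → ℝ}
    (ha0 : ∀ b e, 0 ≤ a b e) (ha1 : ∀ b e, a b e ≤ 1)
    (ha : ∀ b b', (∀ e ∉ T, b e = b' e) → a b = a b') (t : ℝ) :
    (bitLaw ι p).real {b | 2 * p * ∑ e ∈ T, a b e + t ≤ ∑ e ∈ T, if b e then a b e else 0}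
      ≤ Real.exp (-t) := by
  classical
  let f : (ι → Bool) → ℝ := fun b =>
    (∑ e ∈ T, if b e then a b e else 0) - 2 * p * ∑ e ∈ T, a b e
  have hresample : ∀ x b : ι → Bool, f (T.piecewise x b)
      = (∑ e ∈ T, if x e then a b e else 0) - 2 * p * ∑ e ∈ T, a b e := fun x b => by
    simp only [f, ha _ b fun _ he => piecewise_eq_of_notMem T x b he]
    exact congrArg (· - _) (sum_congr rfl fun e he => by rw [piecewise_eq_of_mem T x b he])
  have hint : ∫ b, Real.exp (f b) ∂bitLaw ι p ≤ Real.exp 0 := by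
    have hpres := measurePreserving_piecewise (fun _ : ι => bernoulliMeasure true false p) T
    calc ∫ b, Real.exp (f b) ∂bitLaw ι p
        = ∫ z, Real.exp (f (T.piecewise z.1 z.2)) ∂(bitLaw ι p).prod (bitLaw ι p) := by
          rw [bitLaw, ← hpres.map_eq, integral_map hpres.measurable.aemeasurable
            Measurable.of_discrete.aestronglyMeasurable, hpres.map_eq]
      _ = ∫ b, ∫ x, Real.exp (f (T.piecewise x b)) ∂bitLaw ι p ∂bitLaw ι p :=
          integral_prod_symm _ Integrable.of_finite
      _ ≤ ∫ _, 1 ∂bitLaw ι p := by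
          refine integral_mono Integrable.of_finite Integrable.of_finite fun b => ?_
          simp_rw [hresample]
          exact integral_exp_weighted_bits_le_one p T (ha0 b) (ha1 b)
      _ = Real.exp 0 := by simp
  have htail := measureReal_ge_le_of_integral_exp_le Integrable.of_finite hint t
  simpa only [f, le_sub_iff_add_le', zero_sub] using htail

lemma bitLaw_sum_le_le (p : unitInterval) (T : Finset ι) :
    (bitLaw ι p).real {b | (∑ e ∈ T, if b e then (1 : ℝ) else 0) ≤ p * #T / 4}
      ≤ Real.exp (-(p * #T / 4)) := by
  have hmgf : (p : ℝ) * ∑ _e ∈ T, (Real.exp (-1) - 1) ≤ -(p * #T / 2) := by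
    rw [sum_const, nsmul_eq_mul]
    have h := mul_le_mul_of_nonneg_left Real.exp_neg_one_lt_half.le
      (mul_nonneg p.2.1 (Nat.cast_nonneg (α := ℝ) #T))
    linarith
  have htail := measureReal_ge_le_of_integral_exp_le Integrable.of_finite
    ((integral_exp_sum_bits_le p T fun _ => -1).trans (Real.exp_le_exp.2 hmgf)) (-(p * #T / 4))
  convert htail using 3
  · ext b
    rw [← neg_le_neg_iff, ← sum_neg_distrib]
    simp only [neg_ite, neg_zero]
  · ring

end Bits

section Outcomes

variable {ι : Type*} [Fintype ι] {L : ℕ}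

/-- The law of `L` independent outcomes for every index, the success probability being `q e` at
the index `e`. -/
def outcomeLaw (L : ℕ) (q : ι → unitInterval) : Measure (ι → Fin L → Bool) :=
  Measure.pi fun e => Measure.pi fun _ : Fin L => bernoulliMeasure true false (q e)

instance (q : ι → unitInterval) : IsProbabilityMeasure (outcomeLaw L q) := by
  unfold outcomeLaw; infer_instance

lemma integral_exp_bernoulli_le (q : unitInterval) (s : ℝ) :
    ∫ b, Real.exp (s * ((if b then (1 : ℝ) else 0) - q)) ∂bernoulliMeasure true false q
      ≤ Real.exp (s ^ 2 / 8) := by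
  have hoeffding := (hasSubgaussianMGF_of_mem_Icc_of_integral_eq_zero (a := -(q : ℝ)) (b := 1 - q)
    (μ := bernoulliMeasure true false q) (X := fun b : Bool => (if b then (1 : ℝ) else 0) - q)
    Measurable.of_discrete.aemeasurable
    (Filter.Eventually.of_forall fun b => by cases b <;> simp)
    (by
      rw [integral_bernoulliMeasure]
      simp only [if_true, if_false, Bool.false_eq_true, smul_eq_mul]
      ring)).mgf_le s
  refine hoeffding.trans_eq (congrArg Real.exp ?_)
  simp only [sub_neg_eq_add, sub_add_cancel, nnnorm_one, one_div, inv_pow, NNReal.coe_inv,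
    NNReal.coe_pow, NNReal.coe_ofNat]
  ring

lemma exp_mul_mean_sub (hL : 1 ≤ L) (s q : ℝ) (x : Fin L → ℝ) :
    Real.exp (s * (1 / (L : ℝ) * (∑ l, x l) - q)) = ∏ l, Real.exp (s / L * (x l - q)) := by
  rw [← Real.exp_sum, ← mul_sum, sum_sub_distrib, sum_const, card_univ, Fintype.card_fin,
    nsmul_eq_mul]
  congr 1
  field_simp

lemma integral_exp_outcomes_le (hL : 1 ≤ L) (q : ι → unitInterval) (s : ι → ℝ) :
    ∫ y, Real.exp (∑ e, s e * (1 / (L : ℝ) * (∑ l, if y e l then 1 else 0) - q e))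
      ∂outcomeLaw L q ≤ Real.exp (1 / (8 * L) * ∑ e, s e ^ 2) := by
  simp_rw [Real.exp_sum, exp_mul_mean_sub hL]
  rw [outcomeLaw, integral_fintype_prod_eq_prod (fun e (y : Fin L → Bool) =>
    ∏ l, Real.exp (s e / L * ((if y l then (1 : ℝ) else 0) - q e))), mul_sum, Real.exp_sum]
  refine prod_le_prod (fun e _ => integral_nonneg fun y =>
    prod_nonneg fun l _ => (Real.exp_pos _).le) fun e _ => ?_
  rw [integral_fintype_prod_eq_prod (fun _ (b : Bool) =>
    Real.exp (s e / L * ((if b then (1 : ℝ) else 0) - q e)))]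
  calc _ ≤ ∏ _l : Fin L, Real.exp ((s e / L) ^ 2 / 8) :=
        prod_le_prod (fun l _ => integral_nonneg fun b => (Real.exp_pos _).le)
          fun l _ => integral_exp_bernoulli_le (q e) (s e / L)
    _ = Real.exp (1 / (8 * L) * s e ^ 2) := by
        rw [prod_const, card_univ, Fintype.card_fin, ← Real.exp_nat_mul]
        congr 1
        field_simp

lemma outcomeLaw_sum_ge_le (hL : 1 ≤ L) (q : ι → unitInterval) {a : ι → ℝ} {v t : ℝ} (hv : 0 < v)
    (ha : ∑ e, a e ^ 2 ≤ v) (ht : 0 ≤ t) :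
    (outcomeLaw L q).real
      {y | t ≤ ∑ e, a e * (1 / (L : ℝ) * (∑ l, if y e l then 1 else 0) - q e)}
      ≤ Real.exp (-(2 * L * t ^ 2 / v)) := by
  -- `s` minimizes `s ^ 2 * v / (8 * L) - s * t`
  set s : ℝ := 4 * L * t / v with hs
  have hmgf : 1 / (8 * L) * ∑ e, (s * a e) ^ 2 ≤ 2 * L * t ^ 2 / v := by
    simp_rw [mul_pow]
    rw [← mul_sum]
    calc 1 / (8 * L) * (s ^ 2 * ∑ e, a e ^ 2) ≤ 1 / (8 * L) * (s ^ 2 * v) := by gcongr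
      _ = 2 * L * t ^ 2 / v := by rw [hs]; field_simp; ring
  have htail := measureReal_ge_le_of_integral_exp_le Integrable.of_finite
    ((integral_exp_outcomes_le hL q fun e => s * a e).trans (Real.exp_le_exp.2 hmgf)) (s * t)
  refine (measureReal_mono fun y hy => ?_).trans (htail.trans_eq (congrArg Real.exp ?_))
  · simp only [Set.mem_ofPred_eq, mul_assoc s, ← mul_sum]
    exact mul_le_mul_of_nonneg_left hy (by positivity)
  · rw [hs]; field_simp; ring

lemma outcomeLaw_abs_sum_gt_le (hL : 1 ≤ L) (q : ι → unitInterval) {a : ι → ℝ} {v t : ℝ}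
    (hv : 0 < v) (ha : ∑ e, a e ^ 2 ≤ v) (ht : 0 ≤ t) :
    (outcomeLaw L q).real
      {y | t < |∑ e, a e * (1 / (L : ℝ) * (∑ l, if y e l then 1 else 0) - q e)|}
      ≤ 2 * Real.exp (-(2 * L * t ^ 2 / v)) := by
  have hupper := outcomeLaw_sum_ge_le hL q hv ha ht
  have hlower := outcomeLaw_sum_ge_le (a := fun e => -a e) hL q hv (by simpa using ha) ht
  simp only [neg_mul, sum_neg_distrib] at hlower
  rw [two_mul]
  refine (measureReal_mono fun y (hy : t < |_|) => ?_).trans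
    ((measureReal_union_le _ _).trans (add_le_add hupper hlower))
  rcases lt_abs.1 hy with h | h
  exacts [.inl h.le, .inr h.le]

end Outcomes

/-! ## The random comparison graph -/

section RandomGraph

variable {n : ℕ}

/-- The graph whose edges are the pairs with bit `true`. -/
def ofBits (b : ItemPair n → Bool) : SimpleGraph (Fin n) where
  Adj i j := (∃ h : j < i, b ⟨(i, j), h⟩ = true) ∨ ∃ h : i < j, b ⟨(j, i), h⟩ = true
  symm := ⟨fun _ _ h => h.symm⟩
  loopless := ⟨fun i h => by simp at h⟩

lemma ofBits_adj_pair (b : ItemPair n → Bool) (e : ItemPair n) :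
    (ofBits b).Adj e.1.1 e.1.2 ↔ b e = true := by
  simp [ofBits, e.2, e.2.not_gt]

lemma edgeWeight_ofBits_pair (b : ItemPair n → Bool) (e : ItemPair n) :
    edgeWeight (ofBits b) e.1.1 e.1.2 = if b e then 1 else 0 := by
  simp [edgeWeight, ofBits_adj_pair]

lemma ofBits_bijective : Function.Bijective (ofBits (n := n)) := by
  classical
  refine ⟨fun b b' h => funext fun e => Bool.eq_iff_iff.2 ?_, fun G =>
    ⟨fun e => decide (G.Adj e.1.1 e.1.2), ?_⟩⟩
  · rw [← ofBits_adj_pair, h, ofBits_adj_pair]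
  · ext i j
    rcases lt_trichotomy i j with h | rfl | h
    · simp [ofBits, h, h.not_gt, G.adj_comm i j]
    · simp [ofBits]
    · simp [ofBits, h, h.not_gt]

lemma injective_sym2_itemPair :
    Function.Injective fun e : ItemPair n => s(e.1.1, e.1.2) := by
  rintro ⟨⟨i, j⟩, h⟩ ⟨⟨i', j'⟩, h'⟩ he
  simp only [Sym2.eq_iff] at he
  rcases he with ⟨rfl, rfl⟩ | ⟨rfl, rfl⟩
  · rfl
  · exact absurd h h'.not_gt

lemma ncard_edgeSet_ofBits (b : ItemPair n → Bool) :
    (ofBits b).edgeSet.ncard = #{e | b e = true} := by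
  have himage : (ofBits b).edgeSet
      = (fun e : ItemPair n => s(e.1.1, e.1.2)) '' ↑(univ.filter fun e => b e = true) := by
    ext x
    induction x using Sym2.ind with
    | _ i j =>
    simp only [SimpleGraph.mem_edgeSet, Set.mem_image, coe_filter, mem_univ, true_and,
      Set.mem_ofPred_eq]
    constructor
    · rintro (⟨h, hb⟩ | ⟨h, hb⟩)
      · exact ⟨_, hb, rfl⟩
      · exact ⟨_, hb, Sym2.eq_swap⟩
    · rintro ⟨e, he, hx⟩
      rw [← SimpleGraph.mem_edgeSet, ← hx, SimpleGraph.mem_edgeSet]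
      exact (ofBits_adj_pair b e).2 he
  rw [himage, Set.ncard_image_of_injective _ injective_sym2_itemPair, Set.ncard_coe_finset]

lemma card_itemPair (n : ℕ) : Fintype.card (ItemPair n) = n.choose 2 := by
  have htop : ofBits (n := n) (fun _ => true) = ⊤ := by
    ext i j
    simp only [ofBits, SimpleGraph.top_adj, exists_prop, and_true, ne_iff_lt_or_gt, or_comm]
  have hcard := ncard_edgeSet_ofBits (n := n) fun _ => true
  rw [htop, ← SimpleGraph.coe_edgeFinset, Set.ncard_coe_finset,
    SimpleGraph.card_edgeFinset_top_eq_card_choose_two, Fintype.card_fin] at hcard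
  simpa using hcard.symm

instance : MeasurableSingletonClass (SimpleGraph (Fin n)) where
  measurableSet_singleton G := by
    have hpre : ({G} : Set (SimpleGraph (Fin n))) = SimpleGraph.edgeSet ⁻¹' {G.edgeSet} := by
      ext H; simp
    rw [hpre]
    exact SimpleGraph.measurable_edgeSet (measurableSet_singleton _)

lemma binomialRandom_eq_map_ofBits (p : unitInterval) :
    SimpleGraph.binomialRandom (Fin n) p = (bitLaw (ItemPair n) p).map ofBits := by
  refine Measure.ext_of_singleton fun G => ?_
  obtain ⟨b, rfl⟩ := ofBits_bijective.surjective G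
  have hbit : ∀ e, bernoulliMeasure true false p {b e}
      = if b e = true then (unitInterval.toNNReal p : ENNReal)
        else unitInterval.toNNReal (unitInterval.symm p) := fun e => by
    cases b e <;> simp
  have hcompl := card_filter_add_card_filter_not (s := (univ : Finset (ItemPair n)))
    (fun e => b e = true)
  rw [card_univ, card_itemPair] at hcompl
  rw [Measure.map_apply Measurable.of_discrete (measurableSet_singleton _),
    SimpleGraph.binomialRandom_singleton, ← Set.image_singleton,
    Set.preimage_image_eq _ ofBits_bijective.injective, bitLaw, Measure.pi_singleton,
    prod_congr rfl fun e _ => hbit e, prod_ite, prod_const, prod_const, ncard_edgeSet_ofBits,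
    Nat.card_eq_fintype_card, Fintype.card_fin]
  congr 2
  omega

/-- The law of a sample, described by the bits of its comparison graph and its outcomes. -/
def bitSampleLaw (L : ℕ) (p : unitInterval) (θ : Fin n → ℝ) :
    Measure ((ItemPair n → Bool) × (ItemPair n → Fin L → Bool)) :=
  (bitLaw (ItemPair n) p).prod (outcomeLaw L fun e : ItemPair n => winProb θ e.1.1 e.1.2)

instance (L : ℕ) (p : unitInterval) (θ : Fin n → ℝ) :
    IsProbabilityMeasure (bitSampleLaw L p θ) := by
  unfold bitSampleLaw; infer_instance

lemma sampleLaw_real (L : ℕ) (p : unitInterval) (θ : Fin n → ℝ) (S : Set (Sample n L)) :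
    (sampleLaw L p θ).real S = (bitSampleLaw L p θ).real {z | (ofBits z.1, z.2) ∈ S} := by
  have hmap : sampleLaw L p θ = (bitSampleLaw L p θ).map (Prod.map ofBits id) := by
    rw [bitSampleLaw, ← Measure.map_prod_map _ _ Measurable.of_discrete measurable_id,
      Measure.map_id, ← binomialRandom_eq_map_ofBits]
    rfl
  rw [hmap, map_measureReal_apply Measurable.of_discrete (Set.toFinite S).measurableSet]
  rfl

end RandomGraph

section Fubini

variable {α β : Type*} [MeasurableSpace α] [MeasurableSpace β] {μ : Measure α} {ν : Measure β}
  [IsProbabilityMeasure μ] [IsProbabilityMeasure ν] {A : Set (α × β)} {t : ℝ}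

lemma prod_real_le_of_forall_left (hA : MeasurableSet A)
    (h : ∀ x, ν.real {y | (x, y) ∈ A} ≤ t) : (μ.prod ν).real A ≤ t := by
  have hbound : (μ.prod ν) A ≤ ENNReal.ofReal t := by
    rw [Measure.prod_apply hA]
    calc ∫⁻ x, ν (Prod.mk x ⁻¹' A) ∂μ ≤ ∫⁻ _, ENNReal.ofReal t ∂μ :=
          lintegral_mono fun x => (ENNReal.le_ofReal_iff_toReal_le (measure_ne_top _ _)
            (measureReal_nonneg.trans (h x))).2 (h x)
      _ = ENNReal.ofReal t := by simp
  obtain ⟨x⟩ := μ.nonempty_of_neZero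
  exact ENNReal.toReal_le_of_le_ofReal (measureReal_nonneg.trans (h x)) hbound

lemma prod_real_le_of_forall_right (hA : MeasurableSet A)
    (h : ∀ y, μ.real {x | (x, y) ∈ A} ≤ t) : (μ.prod ν).real A ≤ t := by
  rw [← Measure.prod_swap, map_measureReal_apply measurable_swap hA]
  exact prod_real_le_of_forall_left (measurable_swap hA) h

end Fubini

section Cuts

variable {n L : ℕ}

/-- The pairs with exactly one item in `S`. -/
def crossing (S : Finset (Fin n)) : Finset (ItemPair n) :=
  univ.filter fun e => ¬(e.1.1 ∈ S ↔ e.1.2 ∈ S)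

lemma sum_crossing (S : Finset (Fin n)) {h : Fin n → Fin n → ℝ}
    (hsymm : ∀ i ∈ S, ∀ j ∉ S, h j i = h i j) :
    ∑ e ∈ crossing S, h e.1.1 e.1.2 = ∑ i ∈ S, ∑ j ∈ Sᶜ, h i j := by
  let f : Fin n → Fin n → ℝ := fun i j => if i ∈ S then if j ∈ Sᶜ then h i j else 0 else 0
  have hsum : ∑ i, ∑ j, f i j = ∑ i ∈ S, ∑ j ∈ Sᶜ, h i j := by
    have hrow : ∀ i, ∑ j, f i j = if i ∈ S then ∑ j ∈ Sᶜ, h i j else 0 := fun i => by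
      simp only [f]
      split_ifs <;> simp only [sum_ite_mem, univ_inter, sum_const_zero]
    rw [sum_congr rfl fun i _ => hrow i, sum_ite_mem, univ_inter]
  have hpairs : ∑ e ∈ crossing S, h e.1.1 e.1.2
      = ∑ e : ItemPair n, (f e.1.1 e.1.2 + f e.1.2 e.1.1) := by
    rw [crossing, sum_filter]
    refine sum_congr rfl fun e _ => ?_
    by_cases hi : e.1.1 ∈ S <;> by_cases hj : e.1.2 ∈ S
    · simp [f, hi, hj]
    · simp [f, hi, hj]
    · simpa [f, hi, hj] using hsymm _ hj _ hi
    · simp [f, hi, hj]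
  have htwice := two_mul_sum_itemPair (h := fun i j => f i j + f j i) (fun i j => add_comm _ _)
    (fun i => by by_cases hi : i ∈ S <;> simp [f, hi])
  simp only [← hpairs, sum_add_distrib (s := univ (α := Fin n))] at htwice
  rw [sum_comm (f := fun i j => f j i), hsum] at htwice
  linarith

lemma card_crossing (S : Finset (Fin n)) : (#(crossing S) : ℝ) = #S * (n - #S) := by
  have h := sum_crossing S (h := fun _ _ => 1) fun _ _ _ _ => rfl
  simp only [sum_const, nsmul_eq_mul, mul_one] at h
  rw [h, card_compl, Fintype.card_fin, Nat.cast_sub (by simpa using card_le_univ S)]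

lemma cutWeight_ofBits (b : ItemPair n → Bool) (S : Finset (Fin n)) :
    ∑ i ∈ S, ∑ j ∈ Sᶜ, edgeWeight (ofBits b) i j = ∑ e ∈ crossing S, if b e then 1 else 0 := by
  rw [← sum_crossing S fun i _ j _ => (isConductance_edgeWeight _).symm i j]
  simp only [edgeWeight_ofBits_pair]

/-- The item paired with `m` in a pair that contains `m`. -/
def opponent (m : Fin n) (e : ItemPair n) : Fin n := if e.1.1 = m then e.1.2 else e.1.1

lemma sum_crossing_singleton (m : Fin n) {h : Fin n → Fin n → ℝ} (hsymm : ∀ j ≠ m, h j m = h m j) :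
    ∑ e ∈ crossing {m}, h e.1.1 e.1.2 = ∑ j ∈ {m}ᶜ, h m j := by
  rw [sum_crossing, sum_singleton]
  intro i hi j hj
  rw [mem_singleton.1 hi]
  exact hsymm j (mem_singleton.not.1 hj)

lemma sum_opponent_le (m : Fin n) {a : Fin n → ℝ} (ha : ∀ j, 0 ≤ a j) :
    ∑ e ∈ crossing {m}, a (opponent m e) ≤ ∑ j, a j := by
  simp only [opponent]
  rw [sum_crossing_singleton m (h := fun i j => a (if i = m then j else i))
    fun j hj => by simp [hj]]
  simp only [if_true]
  exact sum_le_univ_sum_of_nonneg ha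

lemma sum_edgeWeight_ofBits_mul (b : ItemPair n → Bool) (m : Fin n) (a : Fin n → ℝ) :
    ∑ j, edgeWeight (ofBits b) m j * a j
      = ∑ e ∈ crossing {m}, if b e then a (opponent m e) else 0 := by
  have hpair : ∀ e : ItemPair n, (if b e then a (opponent m e) else 0)
      = edgeWeight (ofBits b) e.1.1 e.1.2 * a (if e.1.1 = m then e.1.2 else e.1.1) := fun e => by
    rw [edgeWeight_ofBits_pair, ite_mul, one_mul, zero_mul, opponent]
  rw [sum_congr rfl fun e _ => hpair e, sum_crossing_singleton m
    (h := fun i j => edgeWeight (ofBits b) i j * a (if i = m then j else i))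
    fun j hj => by rw [if_neg hj, if_pos rfl, (isConductance_edgeWeight _).symm],
    Fintype.sum_eq_add_sum_compl m, edgeWeight_self, zero_mul, zero_add]
  simp only [if_true]

lemma sum_edgeWeight_ofBits (b : ItemPair n → Bool) (m : Fin n) :
    ∑ j, edgeWeight (ofBits b) m j = ∑ e ∈ crossing {m}, if b e then 1 else 0 := by
  simpa only [mul_one] using sum_edgeWeight_ofBits_mul b m fun _ => 1

lemma divergence_noise_ofBits (b : ItemPair n → Bool) (θ : Fin n → ℝ)
    (y : ItemPair n → Fin L → Bool) (m : Fin n) :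
    divergence (edgeWeight (ofBits b)) (noise θ y) m
      = ∑ e, (if e ∈ crossing {m} then if b e then if e.1.1 = m then 1 else -1 else 0 else 0) *
        (meanOutcome y e - winProb θ e.1.1 e.1.2) := by
  have hpair : ∀ e : ItemPair n, (if e ∈ crossing {m} then
        if b e then if e.1.1 = m then (1 : ℝ) else -1 else 0 else 0) *
        (meanOutcome y e - winProb θ e.1.1 e.1.2)
      = if e ∈ crossing {m} then edgeWeight (ofBits b) e.1.1 e.1.2 *
        ((if e.1.1 = m then 1 else -1) * noise θ y e.1.1 e.1.2) else 0 := fun e => by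
    rw [edgeWeight_ofBits_pair, noise, altExt_pair, coe_winProb]
    split_ifs <;> ring
  rw [sum_congr rfl fun e _ => hpair e, sum_ite_mem, univ_inter, sum_crossing_singleton m
    (h := fun i j => edgeWeight (ofBits b) i j * ((if i = m then 1 else -1) * noise θ y i j))
    fun j hj => by
      rw [if_neg hj, if_pos rfl, (isConductance_edgeWeight _).symm, noise_antisymm]; ring,
    divergence, Fintype.sum_eq_add_sum_compl m, edgeWeight_self, zero_mul, zero_add]
  simp only [if_true, one_mul]

end Cuts

/-! ## Regular samples -/

section Graph

variable {n : ℕ}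

lemma bitLaw_exists_degree_gt_le (p : unitInterval) {t : ℝ} (ht : t ≤ n * p) :
    (bitLaw (ItemPair n) p).real {b | ∃ i, 3 * ((n : ℝ) * p) < ∑ j, edgeWeight (ofBits b) i j}
      ≤ n * Real.exp (-t) := by
  refine (measureReal_exists_le (t := fun _ => Real.exp (-t)) fun i => ?_).trans_eq (by simp)
  refine (measureReal_mono fun b hb => ?_).trans
    (bitLaw_weighted_sum_ge_le p (crossing {i}) (a := fun _ _ => 1) (fun _ _ => zero_le_one)
      (fun _ _ => le_rfl) (fun _ _ _ => rfl) t)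
  have hcard : ∑ _e ∈ crossing {i}, (1 : ℝ) ≤ n := by
    simpa using sum_opponent_le i (a := fun _ => 1) fun _ => zero_le_one
  simp only [Set.mem_ofPred_eq, sum_edgeWeight_ofBits] at hb ⊢
  linarith [mul_le_mul_of_nonneg_left hcard p.2.1]

lemma bitLaw_cut_lt_le (p : unitInterval) {S : Finset (Fin n)} (hS : 2 * #S ≤ n) :
    (bitLaw (ItemPair n) p).real
      {b | ∑ i ∈ S, ∑ j ∈ Sᶜ, edgeWeight (ofBits b) i j < n * p / 8 * #S}
      ≤ Real.exp (-(n * p / 8)) ^ #S := by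
  have hS' : (2 : ℝ) * #S ≤ n := by exact_mod_cast hS
  have hmean : (n : ℝ) * p / 8 * #S ≤ p * #(crossing S) / 4 := by
    rw [card_crossing]
    have h : (0 : ℝ) ≤ p * #S * (n - 2 * #S) :=
      mul_nonneg (mul_nonneg p.2.1 (Nat.cast_nonneg _)) (sub_nonneg.2 hS')
    linarith
  refine (measureReal_mono fun b hb => ?_).trans ((bitLaw_sum_le_le p (crossing S)).trans ?_)
  · rw [Set.mem_ofPred_eq, cutWeight_ofBits] at hb
    exact hb.le.trans hmean
  · rw [← Real.exp_nat_mul, Real.exp_le_exp]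
    linarith

lemma sum_pow_card_sub_zero_pow_le {α : Type*} [Fintype α] {x : ℝ} (hx0 : 0 ≤ x)
    (hx1 : Fintype.card α * x ≤ 1) :
    ∑ S : Finset α, (x ^ #S - 0 ^ #S) ≤ 2 * (Fintype.card α * x) := by
  have hbinom : ∀ z : ℝ, ∑ S : Finset α, z ^ #S = (z + 1) ^ Fintype.card α := fun z => by
    simpa using sum_pow_mul_eq_add_pow z 1 (univ : Finset α)
  rw [sum_sub_distrib, hbinom, hbinom, zero_add, one_pow]
  have hexp : (x + 1) ^ Fintype.card α ≤ Real.exp (Fintype.card α * x) := by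
    rw [Real.exp_nat_mul]
    exact pow_le_pow_left₀ (by positivity) (Real.add_one_le_exp x) _
  linarith [exp_sub_one_le_two_mul (by positivity) hx1]

lemma bitLaw_not_hasEdgeExpansion_le (p : unitInterval) {t : ℝ} (ht : 8 * t ≤ n * p)
    (hnt : n * Real.exp (-t) ≤ 1) :
    (bitLaw (ItemPair n) p).real {b | ¬ HasEdgeExpansion (edgeWeight (ofBits b)) (n * p / 8)}
      ≤ 2 * (n * Real.exp (-t)) := by
  simp only [HasEdgeExpansion, not_forall, not_le, Fintype.card_fin]
  refine (measureReal_exists_le (t := fun S => Real.exp (-t) ^ #S - 0 ^ #S) fun S => ?_).trans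
    ((sum_pow_card_sub_zero_pow_le (Real.exp_pos _).le (by simpa using hnt)).trans_eq (by simp))
  rcases S.eq_empty_or_nonempty with rfl | hS
  · simp
  rw [zero_pow (card_pos.2 hS).ne', sub_zero]
  by_cases hcard : 2 * #S ≤ n
  · simp only [hcard, exists_true_left]
    refine (bitLaw_cut_lt_le p hcard).trans (pow_le_pow_left₀ (Real.exp_pos _).le ?_ _)
    exact Real.exp_le_exp.2 (by linarith)
  · simp only [hcard, IsEmpty.exists_iff, Set.ofPred_false, measureReal_empty]
    positivity

lemma isolate_ofBits_congr {m : Fin n} {b b' : ItemPair n → Bool}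
    (h : ∀ e ∉ crossing {m}, b e = b' e) :
    isolate (edgeWeight (ofBits b)) m = isolate (edgeWeight (ofBits b')) m := by
  have hpair : ∀ e : ItemPair n, e.1.1 ≠ m → e.1.2 ≠ m →
      edgeWeight (ofBits b) e.1.1 e.1.2 = edgeWeight (ofBits b') e.1.1 e.1.2 := fun e hi hj => by
    rw [edgeWeight_ofBits_pair, edgeWeight_ofBits_pair, h e (by simp [crossing, hi, hj])]
  funext i j
  unfold isolate
  split_ifs with hij
  · rfl
  obtain ⟨hi, hj⟩ := not_or.1 hij
  rcases lt_trichotomy i j with hlt | rfl | hlt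
  · rw [(isConductance_edgeWeight _).symm, (isConductance_edgeWeight (ofBits b')).symm]
    exact hpair ⟨(j, i), hlt⟩ hj hi
  · rw [edgeWeight_self, edgeWeight_self]
  · exact hpair ⟨(i, j), hlt⟩ hi hj

lemma bitLaw_not_isTypicalRow_le (p : unitInterval) (m : Fin n)
    {x : (ItemPair n → Bool) → Fin n → ℝ}
    (hx : ∀ b b', (∀ e ∉ crossing {m}, b e = b' e) → x b = x b') (t : ℝ) :
    (bitLaw (ItemPair n) p).real {b | ¬ IsTypicalRow (edgeWeight (ofBits b) m) p t (x b)}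
      ≤ Real.exp (-t) := by
  refine (measureReal_mono fun b hb => ?_).trans
    (bitLaw_weighted_sum_ge_le p (crossing {m}) (a := fun b e => |x b (opponent m e)| / ‖x b‖)
      (fun b e => by positivity)
      (fun b e => div_le_one_of_le₀ (norm_le_pi_norm (x b) _) (norm_nonneg _))
      (fun b b' h => by simp only [hx b b' h]) t)
  simp only [Set.mem_ofPred_eq, IsTypicalRow, not_le, sum_edgeWeight_ofBits_mul] at hb ⊢
  have hpos : 0 < ‖x b‖ := by
    rw [norm_pos_iff]
    intro h0
    simp [h0] at hb
  have hscale : ∑ e ∈ crossing {m}, (if b e then |x b (opponent m e)| / ‖x b‖ else 0)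
      = (∑ e ∈ crossing {m}, if b e then |x b (opponent m e)| else 0) / ‖x b‖ := by
    rw [sum_div]
    exact sum_congr rfl fun e _ => by split_ifs <;> simp
  rw [hscale, ← sum_div, le_div_iff₀ hpos, add_mul, mul_assoc, div_mul_cancel₀ _ hpos.ne']
  have hsum := sum_opponent_le m (a := fun j => |x b j|) fun j => abs_nonneg _
  linarith [mul_le_mul_of_nonneg_left hsum (mul_nonneg zero_le_two p.2.1)]

end Graph

section Noise

variable {n L : ℕ}

lemma outcomeLaw_exists_abs_noise_gt_le (hL : 1 ≤ L) (θ : Fin n → ℝ) {t : ℝ} (ht : 0 ≤ t) :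
    (outcomeLaw L fun e : ItemPair n => winProb θ e.1.1 e.1.2).real
      {y | ∃ i j, t < |noise θ y i j|} ≤ n ^ 2 * (2 * Real.exp (-(2 * L * t ^ 2))) := by
  classical
  have hpair : ∀ e : ItemPair n,
      (outcomeLaw L fun e : ItemPair n => winProb θ e.1.1 e.1.2).real
        {y | t < |meanOutcome y e - winProb θ e.1.1 e.1.2|}
        ≤ 2 * Real.exp (-(2 * L * t ^ 2)) := fun e => by
    have h := outcomeLaw_abs_sum_gt_le hL (fun e : ItemPair n => winProb θ e.1.1 e.1.2)
      (a := Pi.single e 1) one_pos (by simp [Pi.single_apply]) ht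
    simpa only [meanOutcome, div_one, Pi.single_apply, ite_mul, one_mul, zero_mul, sum_ite_eq',
      mem_univ, if_true] using h
  refine (measureReal_mono fun y hy => ?_).trans ((measureReal_exists_le hpair).trans ?_)
  · contrapose! hy
    simp only [Set.mem_ofPred_eq, not_exists, not_lt, coe_winProb] at hy ⊢
    exact abs_altExt_le ht hy
  · rw [sum_const, nsmul_eq_mul, card_univ, card_itemPair]
    gcongr
    exact_mod_cast Nat.choose_le_pow n 2

lemma outcomeLaw_exists_abs_divergence_noise_gt_le (hL : 1 ≤ L) (θ : Fin n → ℝ)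
    (b : ItemPair n → Bool) {v t : ℝ} (hv : 0 < v) (ht : 0 ≤ t) :
    (outcomeLaw L fun e : ItemPair n => winProb θ e.1.1 e.1.2).real
      {y | (∀ i, ∑ j, edgeWeight (ofBits b) i j ≤ v) ∧
        ∃ i, t < |divergence (edgeWeight (ofBits b)) (noise θ y) i|}
      ≤ n * (2 * Real.exp (-(2 * L * t ^ 2 / v))) := by
  by_cases hdeg : ∀ i, ∑ j, edgeWeight (ofBits b) i j ≤ v
  swap
  · simp only [hdeg, false_and, Set.ofPred_false, measureReal_empty]
    positivity
  simp only [hdeg, implies_true, true_and]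
  refine (measureReal_exists_le (t := fun _ => 2 * Real.exp (-(2 * L * t ^ 2 / v)))
    fun i => ?_).trans_eq (by simp)
  simp only [divergence_noise_ofBits]
  refine outcomeLaw_abs_sum_gt_le hL _ hv ?_ ht
  have hsq : ∀ e : ItemPair n, (if e ∈ crossing {i} then
      if b e then if e.1.1 = i then (1 : ℝ) else -1 else 0 else 0) ^ 2
      = if e ∈ crossing {i} then if b e then 1 else 0 else 0 := fun e => by
    split_ifs <;> norm_num
  rw [sum_congr rfl fun e _ => hsq e, sum_ite_mem, univ_inter, ← sum_edgeWeight_ofBits]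
  exact hdeg i

end Noise

section Regular

variable {n L : ℕ}

/-- The properties of a sample with scores `θ` and edge probability `p` that the deterministic
analysis of the maximum likelihood estimate relies on: the comparison graph has bounded degrees and
expands, the noise is at scale `τ`, and each row of the graph is typical, up to `r`, for the
leave-one-out potential computed without that row. -/
structure IsRegularSample (p : unitInterval) (θ : Fin n → ℝ) (c τ r : ℝ) (ω : Sample n L) :
    Prop where
  degree_le : ∀ i, ∑ j, edgeWeight ω.1 i j ≤ 3 * (n * p)
  hasEdgeExpansion : HasEdgeExpansion (edgeWeight ω.1) (n * p / 8)
  abs_noise_le : ∀ i j, |noise θ ω.2 i j| ≤ √(n * p) * τ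
  abs_divergence_noise_le : ∀ i, |divergence (edgeWeight ω.1) (noise θ ω.2) i| ≤ n * p * τ
  isTypicalRow : ∀ m, IsTypicalRow (edgeWeight ω.1 m) p r
    (looPotential c θ ω.2 m (isolate (edgeWeight ω.1) m))

lemma not_isRegularSample_subset (p : unitInterval) (θ : Fin n → ℝ) (c τ r : ℝ) :
    {z : (ItemPair n → Bool) × (ItemPair n → Fin L → Bool) |
        ¬ IsRegularSample p θ c τ r (ofBits z.1, z.2)} ⊆
      {z | ∃ i, 3 * ((n : ℝ) * p) < ∑ j, edgeWeight (ofBits z.1) i j} ∪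
      ({z | ¬ HasEdgeExpansion (edgeWeight (ofBits z.1)) (n * p / 8)} ∪
      ({z | ∃ i j, √((n : ℝ) * p) * τ < |noise θ z.2 i j|} ∪
      ({z | (∀ i, ∑ j, edgeWeight (ofBits z.1) i j ≤ 3 * ((n : ℝ) * p)) ∧
          ∃ i, (n : ℝ) * p * τ < |divergence (edgeWeight (ofBits z.1)) (noise θ z.2) i|} ∪
      {z | ∃ m, ¬ IsTypicalRow (edgeWeight (ofBits z.1) m) p r
          (looPotential c θ z.2 m (isolate (edgeWeight (ofBits z.1)) m))}))) := by
  intro z hz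
  contrapose! hz
  simp only [Set.mem_union, Set.mem_ofPred_eq, not_or, not_exists, not_and, not_lt, not_not] at hz ⊢
  obtain ⟨hdeg, hexp, hnoise, hdiv, hrow⟩ := hz
  exact ⟨hdeg, hexp, hnoise, hdiv hdeg, hrow⟩

lemma sq_mul_exp_neg_le {x s t : ℝ} (hx : 0 ≤ x) (ht : x * Real.exp (-t) ≤ 1) (hs : 2 * t ≤ s) :
    x ^ 2 * Real.exp (-s) ≤ x * Real.exp (-t) :=
  calc x ^ 2 * Real.exp (-s) ≤ x ^ 2 * Real.exp (-t + -t) := by gcongr; linarith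
    _ = x * Real.exp (-t) * (x * Real.exp (-t)) := by rw [Real.exp_add]; ring
    _ ≤ x * Real.exp (-t) := mul_le_of_le_one_right (by positivity) ht

lemma bitSampleLaw_not_isRegularSample_le (hL : 1 ≤ L) (p : unitInterval) (θ : Fin n → ℝ) (c : ℝ)
    {t τ : ℝ} (ht : 0 < t) (hτ : 0 ≤ τ) (htp : 8 * t ≤ n * p) (hnt : n * Real.exp (-t) ≤ 1)
    (htτ : 3 * t ≤ 2 * (L * (n * p * τ ^ 2))) :
    (bitSampleLaw L p θ).real {z | ¬ IsRegularSample p θ c τ t (ofBits z.1, z.2)}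
      ≤ 8 * (n * Real.exp (-t)) := by
  have hnp : 0 < (n : ℝ) * p := by linarith
  have hfin : ∀ S : Set ((ItemPair n → Bool) × (ItemPair n → Fin L → Bool)), MeasurableSet S :=
    fun S => (Set.toFinite S).measurableSet
  have hnoise : (n : ℝ) ^ 2 * (2 * Real.exp (-(2 * L * (√(n * p) * τ) ^ 2)))
      ≤ 2 * (n * Real.exp (-t)) := by
    rw [mul_left_comm, mul_pow, Real.sq_sqrt hnp.le]
    exact mul_le_mul_of_nonneg_left (sq_mul_exp_neg_le n.cast_nonneg hnt (by linarith)) zero_le_two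
  have hdiv : (n : ℝ) * (2 * Real.exp (-(2 * L * (n * p * τ) ^ 2 / (3 * (n * p)))))
      ≤ 2 * (n * Real.exp (-t)) := by
    have hexp : 2 * L * ((n : ℝ) * p * τ) ^ 2 / (3 * (n * p))
        = 2 * (L * (n * p * τ ^ 2)) / 3 := by
      field_simp
    rw [hexp, mul_left_comm]
    gcongr
    linarith
  calc (bitSampleLaw L p θ).real {z | ¬ IsRegularSample p θ c τ t (ofBits z.1, z.2)}
      ≤ _ := measureReal_mono (not_isRegularSample_subset p θ c τ t)
    _ ≤ n * Real.exp (-t) + (2 * (n * Real.exp (-t)) + (2 * (n * Real.exp (-t))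
        + (2 * (n * Real.exp (-t)) + n * Real.exp (-t)))) := by
      refine measureReal_union_le_add (prod_real_le_of_forall_right (hfin _) fun _ =>
          bitLaw_exists_degree_gt_le p (by linarith)) <|
        measureReal_union_le_add (prod_real_le_of_forall_right (hfin _) fun _ =>
          bitLaw_not_hasEdgeExpansion_le p htp hnt) <|
        measureReal_union_le_add (prod_real_le_of_forall_left (hfin _) fun _ =>
          (outcomeLaw_exists_abs_noise_gt_le hL θ (by positivity)).trans hnoise) <|
        measureReal_union_le_add (prod_real_le_of_forall_left (hfin _) fun b =>
          (outcomeLaw_exists_abs_divergence_noise_gt_le hL θ b (by positivity)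
            (by positivity)).trans hdiv) <|
        prod_real_le_of_forall_right (hfin _) fun y => ?_
      refine (measureReal_exists_le fun m => bitLaw_not_isTypicalRow_le p m (fun b b' h => ?_)
        t).trans_eq (by simp)
      rw [isolate_ofBits_congr h]
    _ = 8 * (n * Real.exp (-t)) := by ring

end Regular

section Rate

variable {n L : ℕ} {p : unitInterval}

lemma abs_sub_le_log_of_condNumber_le {θ : Fin n → ℝ} {κ : ℝ} (h : condNumber θ ≤ κ)
    (i j : Fin n) : |θ i - θ j| ≤ Real.log κ := by
  have hle : ∀ i j : Fin n, θ i - θ j ≤ Real.log κ := fun i j => by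
    have : Nonempty (Fin n) := ⟨i⟩
    have hpos : 0 < ⨅ i, Real.exp (θ i) := by
      obtain ⟨k, hk⟩ := exists_eq_ciInf_of_finite (f := fun i => Real.exp (θ i))
      exact hk ▸ Real.exp_pos _
    have hsup : Real.exp (θ i) ≤ ⨆ i, Real.exp (θ i) :=
      le_ciSup (f := fun i => Real.exp (θ i)) (Set.finite_range _).bddAbove i
    have hinf : ⨅ i, Real.exp (θ i) ≤ Real.exp (θ j) :=
      ciInf_le (f := fun i => Real.exp (θ i)) (Set.finite_range _).bddBelow j
    rw [← Real.log_exp (θ i - θ j), Real.exp_sub]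
    exact Real.log_le_log (by positivity)
      ((div_le_div₀ ((Real.exp_pos _).le.trans hsup) hsup hpos hinf).trans h)
  exact abs_sub_le_iff.2 ⟨hle i j, hle j i⟩

lemma rate_nonneg : 0 ≤ rate n L p := Real.sqrt_nonneg _

lemma rate_sq (n L : ℕ) (p : unitInterval) :
    rate n L p ^ 2 = Real.log n / ((n : ℝ) * p * L) := by
  have hp := p.2.1
  exact Real.sq_sqrt (by positivity)

lemma half_le_log (hn : 2 ≤ n) : 1 / 2 ≤ Real.log n := by
  have hle : Real.log 2 ≤ Real.log n := Real.log_le_log two_pos (by exact_mod_cast hn)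
  linarith [Real.log_two_gt_d9]

namespace Regime

variable {C₁ C₂ : ℝ}

lemma mul_log_le (h : Regime C₁ C₂ n L p) : C₁ * Real.log n ≤ (n : ℝ) * p := by
  have hn : (0 : ℝ) < n := by exact_mod_cast h.1
  calc C₁ * Real.log n = n * (C₁ * (Real.log n / n)) := by field_simp
    _ ≤ n * p := mul_le_mul_of_nonneg_left h.2.2.1 hn.le

lemma rate_sq_le (h : Regime C₁ C₂ n L p) (hn : 2 ≤ n) (hC₂ : 0 < C₂) :
    rate n L p ^ 2 ≤ 2 / C₂ := by
  have hlog := half_le_log hn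
  have hpos : 0 < C₂ * Real.log n ^ 2 := by positivity
  rw [rate_sq]
  calc Real.log n / ((n : ℝ) * p * L) ≤ Real.log n / (C₂ * Real.log n ^ 2) := by
        exact div_le_div_of_nonneg_left (by linarith) hpos h.2.2.2
    _ = 1 / Real.log n / C₂ := by field_simp
    _ ≤ 2 / C₂ := by
        gcongr
        rw [div_le_iff₀ (by linarith)]
        linarith

lemma mul_rate_sq (h : Regime C₁ C₂ n L p) (hn : 2 ≤ n) (hC₁ : 0 < C₁) :
    L * ((n : ℝ) * p * rate n L p ^ 2) = Real.log n := by
  have hL : (0 : ℝ) < L := by exact_mod_cast h.2.1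
  have hnp : 0 < (n : ℝ) * p :=
    (mul_pos hC₁ (by linarith [half_le_log hn])).trans_le h.mul_log_le
  rw [rate_sq]
  generalize (n : ℝ) * p = N at hnp ⊢
  field_simp

end Regime

end Rate

/-- The constant in front of the rate of the maximum likelihood estimate for scores of condition
number at most `κ`. -/
def rateConst (κ : ℝ) : ℝ := 5 * amplification (truncSlope (Real.log κ))

/-- The ratio of the expected degree to `log n` from which on the comparison graph expands well
enough for scores of condition number at most `κ`. -/
def degreeConst (κ : ℝ) : ℝ := 8 * (1536 / truncSlope (Real.log κ)) ^ 2

lemma rateConst_pos (κ : ℝ) : 0 < rateConst κ := by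
  have := truncSlope_pos (Real.log κ)
  unfold rateConst amplification
  positivity

lemma degreeConst_pos (κ : ℝ) : 0 < degreeConst κ := by
  have := truncSlope_pos (Real.log κ)
  unfold degreeConst
  positivity

lemma le_truncSlope_mul_degreeConst {κ : ℝ} (hκ : 1 ≤ κ) :
    1344 ≤ truncSlope (Real.log κ) * degreeConst κ := by
  have hc := truncSlope_pos (Real.log κ)
  have hc1 := truncSlope_le_one (Real.log_nonneg hκ)
  have heq : truncSlope (Real.log κ) * degreeConst κ = 8 * 1536 ^ 2 / truncSlope (Real.log κ) := by
    unfold degreeConst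
    field_simp
  rw [heq, le_div_iff₀ hc]
  linarith

lemma le_degreeConst {κ : ℝ} (hκ : 1 ≤ κ) : 1344 ≤ degreeConst κ :=
  (le_truncSlope_mul_degreeConst hκ).trans
    (mul_le_of_le_one_left (degreeConst_pos κ).le (truncSlope_le_one (Real.log_nonneg hκ)))

section UpperBound

variable {κ : ℝ} {n L : ℕ} {p : unitInterval} {θ : Fin n → ℝ}

lemma exists_isMLE_of_isRegularSample (hκ : 1 ≤ κ) (hn : 2 ≤ n)
    (hreg : Regime (degreeConst κ) (8 * rateConst κ ^ 2) n L p) (hθ : θ ∈ scoreClass n κ)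
    {ω : Sample n L} (hω : IsRegularSample p θ (truncSlope (Real.log κ)) (5 * rate n L p)
      (14 * Real.log n) ω) :
    ∃ θhat : Fin n → ℝ, IsMLE (observe ω) θhat ∧
      (∀ θ' : Fin n → ℝ, IsMLE (observe ω) θ' → θ' = θhat) ∧
      ‖θhat - θ‖ ≤ rateConst κ * rate n L p := by
  have hlog := half_le_log hn
  have hN : degreeConst κ * (1 / 2) ≤ n * p :=
    (mul_le_mul_of_nonneg_left hlog (degreeConst_pos κ).le).trans hreg.mul_log_le
  have hNpos : 0 < (n : ℝ) * p := by linarith [degreeConst_pos κ]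
  have hW : IsExpander (edgeWeight ω.1) (n * p) :=
    hω.hasEdgeExpansion.isExpander (isConductance_edgeWeight _) (edgeWeight_le_one _)
      (edgeWeight_self _) hω.degree_le hNpos (by simpa using hn)
  have hsmall : rateConst κ * rate n L p ≤ 1 / 2 := by
    have hC := rateConst_pos κ
    refine le_of_sq_le_sq ?_ (by norm_num)
    calc (rateConst κ * rate n L p) ^ 2 = rateConst κ ^ 2 * rate n L p ^ 2 := mul_pow _ _ _
      _ ≤ rateConst κ ^ 2 * (2 / (8 * rateConst κ ^ 2)) := by
        gcongr
        exact hreg.rate_sq_le hn (by positivity)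
      _ = (1 / 2) ^ 2 := by field_simp; norm_num
  have hrow : 14 * Real.log n ≤ truncSlope (Real.log κ) * (n * p) / 96 := by
    have hc := truncSlope_pos (Real.log κ)
    have hle := mul_le_mul_of_nonneg_left hreg.mul_log_le hc.le
    have := mul_le_mul_of_nonneg_right (le_truncSlope_mul_degreeConst hκ)
      (by linarith : 0 ≤ Real.log n)
    linarith
  have hτ : amplification (truncSlope (Real.log κ)) * (5 * rate n L p)
      = rateConst κ * rate n L p := by
    unfold rateConst; ring
  rw [← hτ] at hsmall ⊢
  refine exists_isMLE_of_isExpander hreg.2.1 hθ.1 (Real.log_nonneg hκ)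
    (abs_sub_le_log_of_condNumber_le hθ.2) hW ?_ (mul_nonneg (by norm_num) rate_nonneg) hsmall
    hω.abs_noise_le hω.abs_divergence_noise_le fun m => ?_
  · unfold degreeConst at hN
    linarith
  · rw [mul_div_cancel_left₀ _ (by positivity)]
    exact (hω.isTypicalRow m).mono hrow

theorem isMLE_rate (hκ : 1 ≤ κ) (hreg : Regime (degreeConst κ) (8 * rateConst κ ^ 2) n L p)
    (hθ : θ ∈ scoreClass n κ) :
    1 - 1 / (n : ℝ) ^ 10 ≤ (sampleLaw L p θ).real
      {ω | ∃ θhat : Fin n → ℝ, IsMLE (observe ω) θhat ∧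
        (∀ θ' : Fin n → ℝ, IsMLE (observe ω) θ' → θ' = θhat) ∧
        ‖θhat - θ‖ ≤ rateConst κ * rate n L p} := by
  rcases hreg.1.eq_or_lt with rfl | hn
  · simp
  replace hn : 2 ≤ n := hn
  have hn' : (2 : ℝ) ≤ n := by exact_mod_cast hn
  have hlog := half_le_log hn
  have hexp : n * Real.exp (-(14 * Real.log n)) = 1 / (n : ℝ) ^ 13 := by
    rw [Real.exp_neg, ← Nat.cast_ofNat, Real.exp_nat_mul, Real.exp_log (by linarith)]
    field_simp
  have hbad : 8 * (n * Real.exp (-(14 * Real.log n))) ≤ 1 / (n : ℝ) ^ 10 := by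
    rw [hexp, mul_one_div, div_le_div_iff₀ (by positivity) (by positivity)]
    calc (8 : ℝ) * (n : ℝ) ^ 10 = 2 ^ 3 * (n : ℝ) ^ 10 := by norm_num
      _ ≤ (n : ℝ) ^ 3 * (n : ℝ) ^ 10 := by gcongr
      _ = 1 * (n : ℝ) ^ 13 := by ring
  have hirreg := bitSampleLaw_not_isRegularSample_le hreg.2.1 p θ (truncSlope (Real.log κ))
    (t := 14 * Real.log n) (τ := 5 * rate n L p) (by linarith)
    (mul_nonneg (by norm_num) rate_nonneg) ?_ ?_ ?_
  · rw [sampleLaw_real]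
    refine (sub_le_sub_left (hirreg.trans hbad) 1).trans ?_
    rw [← probReal_compl_eq_one_sub (Set.toFinite _).measurableSet]
    refine measureReal_mono fun z hz => ?_
    exact exists_isMLE_of_isRegularSample hκ hn hreg hθ (not_not.1 hz)
  · have := mul_le_mul_of_nonneg_right (le_degreeConst hκ) (by linarith : 0 ≤ Real.log n)
    linarith [hreg.mul_log_le]
  · rw [hexp, div_le_one (by positivity)]
    exact one_le_pow₀ (by linarith)
  · have := hreg.mul_rate_sq hn (degreeConst_pos κ)
    linarith

end UpperBound

/-! ## The minimax lower bound -/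

section ChangeOfMeasure

variable {α : Type*} [Finite α] [MeasurableSpace α] [MeasurableSingletonClass α]

lemma sq_measureReal_le_of_likelihoodRatio {μ ν : Measure α} [IsFiniteMeasure μ]
    [IsFiniteMeasure ν] {D : α → ℝ} (hD : ∀ y, 0 ≤ D y)
    (h : ∀ y, μ.real {y} = D y * ν.real {y}) (A : Set α) :
    μ.real A ^ 2 ≤ (∫ y, D y ∂μ) * ν.real A := by
  classical
  cases nonempty_fintype α
  have hsum : ∀ ρ : Measure α, ∀ [IsFiniteMeasure ρ], ρ.real A = ∑ y ∈ A.toFinset, ρ.real {y} :=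
    fun ρ _ => by rw [sum_measureReal_singleton, Set.coe_toFinset]
  have hnonneg : ∀ y, 0 ≤ μ.real {y} * D y := fun y => mul_nonneg measureReal_nonneg (hD y)
  rw [hsum μ, hsum ν, integral_fintype Integrable.of_finite]
  simp only [smul_eq_mul]
  calc (∑ y ∈ A.toFinset, μ.real {y}) ^ 2
      ≤ (∑ y ∈ A.toFinset, μ.real {y} * D y) * ∑ y ∈ A.toFinset, ν.real {y} :=
        sum_sq_le_sum_mul_sum_of_sq_le_mul _ (fun y _ => hnonneg y)
          (fun _ _ => measureReal_nonneg) fun y _ => by rw [h]; exact le_of_eq (by ring)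
    _ ≤ (∑ y, μ.real {y} * D y) * ∑ y ∈ A.toFinset, ν.real {y} :=
        mul_le_mul_of_nonneg_right
          (sum_le_sum_of_subset_of_nonneg (subset_univ _) fun y _ _ => hnonneg y)
          (sum_nonneg fun _ _ => measureReal_nonneg)

lemma sq_sum_measureReal_le {ι : Type*} [Fintype ι] {μ : ι → Measure α} {ν : Measure α}
    [IsProbabilityMeasure ν] {A : ι → Set α} (hA : Pairwise fun i j => Disjoint (A i) (A j))
    {χ : ℝ} (hχ : 0 ≤ χ) (h : ∀ i, (μ i).real (A i) ^ 2 ≤ χ * ν.real (A i)) :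
    (∑ i, (μ i).real (A i)) ^ 2 ≤ Fintype.card ι * χ := by
  have hdisj : ∑ i, ν.real (A i) ≤ 1 := by
    rw [← measureReal_iUnion_fintype hA fun i => (Set.toFinite _).measurableSet]
    exact measureReal_le_one
  calc (∑ i, (μ i).real (A i)) ^ 2 ≤ Fintype.card ι * ∑ i, (μ i).real (A i) ^ 2 :=
        sq_sum_le_card_mul_sum_sq
    _ ≤ Fintype.card ι * ∑ i, χ * ν.real (A i) := by gcongr with i; exact h i
    _ = Fintype.card ι * (χ * ∑ i, ν.real (A i)) := by rw [← mul_sum]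
    _ ≤ Fintype.card ι * χ := by gcongr; exact mul_le_of_le_one_right hχ hdisj

end ChangeOfMeasure

section FairCoins

variable {ι : Type*} [Fintype ι] {L : ℕ}

/-- The success probability `1 / 2` of a fair coin. -/
def fairCoin : unitInterval := ⟨1 / 2, by norm_num, by norm_num⟩

lemma outcomeLaw_real_singleton (q : ι → unitInterval) (y : ι → Fin L → Bool) :
    (outcomeLaw L q).real {y} = ∏ e, ∏ l, if y e l then (q e : ℝ) else 1 - q e := by
  rw [measureReal_def, outcomeLaw, Measure.pi_singleton, ENNReal.toReal_prod]
  refine prod_congr rfl fun e _ => ?_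
  rw [Measure.pi_singleton, ENNReal.toReal_prod]
  refine prod_congr rfl fun l _ => ?_
  rw [← measureReal_def]
  cases y e l <;> simp

/-- The likelihood ratio of independent coins with success probabilities `q` with respect to fair
coins. -/
def likelihoodRatio (q : ι → unitInterval) (y : ι → Fin L → Bool) : ℝ :=
  ∏ e, ∏ l, 2 * if y e l then (q e : ℝ) else 1 - q e

lemma likelihoodRatio_nonneg (q : ι → unitInterval) (y : ι → Fin L → Bool) :
    0 ≤ likelihoodRatio q y :=
  prod_nonneg fun e _ => prod_nonneg fun l _ => by
    have := (q e).2.1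
    have := (q e).2.2
    split_ifs <;> linarith

lemma outcomeLaw_real_singleton_eq_mul_fairCoin (q : ι → unitInterval) (y : ι → Fin L → Bool) :
    (outcomeLaw L q).real {y}
      = likelihoodRatio q y * (outcomeLaw L fun _ : ι => fairCoin).real {y} := by
  simp only [outcomeLaw_real_singleton, likelihoodRatio, ← prod_mul_distrib]
  refine prod_congr rfl fun e _ => prod_congr rfl fun l _ => ?_
  split_ifs <;> simp only [fairCoin] <;> ring

lemma integral_likelihoodRatio (q : ι → unitInterval) :
    ∫ y : ι → Fin L → Bool, likelihoodRatio q y ∂outcomeLaw L q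
      = ∏ e, (1 + (2 * (q e : ℝ) - 1) ^ 2) ^ L := by
  simp only [likelihoodRatio]
  rw [outcomeLaw, integral_fintype_prod_eq_prod (fun e (y : Fin L → Bool) =>
    ∏ l, 2 * if y l then (q e : ℝ) else 1 - q e)]
  refine prod_congr rfl fun e _ => ?_
  rw [integral_fintype_prod_eq_prod (fun _ (b : Bool) => 2 * if b then (q e : ℝ) else 1 - q e)]
  simp only [integral_bernoulliMeasure, prod_const, card_univ, Fintype.card_fin]
  congr 1
  simp only [if_true, if_false, Bool.false_eq_true, smul_eq_mul]
  ring

lemma sq_outcomeLaw_real_le (q : ι → unitInterval) (A : Set (ι → Fin L → Bool)) :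
    (outcomeLaw L q).real A ^ 2 ≤ (∏ e, (1 + (2 * (q e : ℝ) - 1) ^ 2) ^ L)
      * (outcomeLaw L fun _ : ι => fairCoin).real A := by
  rw [← integral_likelihoodRatio]
  exact sq_measureReal_le_of_likelihoodRatio (likelihoodRatio_nonneg q)
    (outcomeLaw_real_singleton_eq_mul_fairCoin q) A

lemma outcomeLaw_real_congr {q q' : ι → unitInterval} {T : Set ι} (hq : ∀ e ∈ T, q e = q' e)
    {A : Set (ι → Fin L → Bool)} (hA : DependsOn (· ∈ A) T) :
    (outcomeLaw L q).real A = (outcomeLaw L q').real A := by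
  obtain ⟨B, hB⟩ := dependsOn_iff_exists_comp.1 hA
  have hpre : A = T.domRestrict ⁻¹' {x | B x} := Set.ext fun y => iff_of_eq (congrFun hB y)
  have hmap : ∀ r : ι → unitInterval, (outcomeLaw L r).real A
      = (Measure.infinitePi fun e : T => Measure.pi fun _ : Fin L =>
          bernoulliMeasure true false (r e)).real {x | B x} := fun r => by
    rw [outcomeLaw, ← Measure.infinitePi_eq_pi, hpre,
      ← map_measureReal_apply (by fun_prop) (Set.toFinite _).measurableSet,
      Measure.infinitePi_map_restrict']
  simp only [hmap, fun e : T => hq e e.2]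

end FairCoins

section Spikes

variable {n L : ℕ} {s : ℝ}

/-- The centered score vector in which only the item `k` stands out, by `s`. The `n` spikes are the
hypotheses that no estimator can tell apart. -/
def spike (s : ℝ) (k : Fin n) : Fin n → ℝ := fun i => (if i = k then s else 0) - s / n

lemma spike_mem_scoreClass {κ : ℝ} (hs : 0 ≤ s) (hκ : Real.exp s ≤ κ) (k : Fin n) :
    spike s k ∈ scoreClass n κ := by
  have : Nonempty (Fin n) := ⟨k⟩
  have hn : (n : ℝ) ≠ 0 := by
    have := k.pos
    positivity
  constructor
  · simp only [spike, sum_sub_distrib, sum_ite_eq', mem_univ, if_true, sum_const, card_univ,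
      Fintype.card_fin, nsmul_eq_mul]
    rw [mul_div_cancel₀ _ hn, sub_self]
  · have hsup : (⨆ i, Real.exp (spike s k i)) ≤ Real.exp (s - s / n) :=
      ciSup_le fun i => Real.exp_le_exp.2 (by simp only [spike]; split_ifs <;> linarith)
    have hinf : Real.exp (-(s / n)) ≤ ⨅ i, Real.exp (spike s k i) :=
      le_ciInf fun i => Real.exp_le_exp.2 (by simp only [spike]; split_ifs <;> linarith)
    calc condNumber (spike s k) ≤ Real.exp (s - s / n) / Real.exp (-(s / n)) :=
          div_le_div₀ (Real.exp_pos _).le hsup (Real.exp_pos _) hinf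
      _ = Real.exp s := by rw [← Real.exp_sub]; ring_nf
      _ ≤ κ := hκ

lemma le_norm_spike_sub (hs : 0 ≤ s) {k l : Fin n} (hkl : k ≠ l) :
    s ≤ ‖spike s k - spike s l‖ := by
  have hcoord := norm_le_pi_norm (spike s k - spike s l) k
  simp only [spike, Pi.sub_apply, if_true, hkl, if_false] at hcoord
  rw [Real.norm_of_nonneg (by linarith)] at hcoord
  linarith

lemma spike_sub_sq_le (s : ℝ) (k i j : Fin n) :
    (spike s k i - spike s k j) ^ 2 ≤ if i = k ∨ j = k then s ^ 2 else 0 := by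
  have hs := sq_nonneg s
  by_cases hi : i = k <;> by_cases hj : j = k <;>
    simp only [spike, hi, hj, if_true, if_false, or_self, or_true, true_or] <;> linarith

lemma sq_two_mul_sigmoid_sub_one_le (x : ℝ) : (2 * Real.sigmoid x - 1) ^ 2 ≤ 4 * x ^ 2 := by
  have habs : |Real.sigmoid x - Real.sigmoid 0| ≤ |x| := by
    rcases le_total 0 x with hx | hx
    · rw [abs_of_nonneg (sub_nonneg.2 (Real.sigmoid_le hx)), abs_of_nonneg hx]
      linarith [sigmoid_sub_le hx]
    · rw [abs_of_nonpos (sub_nonpos.2 (Real.sigmoid_le hx)), abs_of_nonpos hx]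
      linarith [sigmoid_sub_le hx]
  have hsq := sq_le_sq.2 habs
  rw [Real.sigmoid_zero] at hsq
  linarith

lemma one_add_sq_two_mul_winProb_spike_sub_one_le (k : Fin n) (e : ItemPair n) :
    1 + (2 * (winProb (spike s k) e.1.1 e.1.2 : ℝ) - 1) ^ 2
      ≤ Real.exp (4 * s ^ 2 * if e ∈ crossing {k} then 1 else 0) := by
  have hmem : e ∈ crossing {k} ↔ e.1.1 = k ∨ e.1.2 = k := by
    simp only [crossing, mem_filter_univ, mem_singleton]
    grind [e.2.ne']
  have hsq := (sq_two_mul_sigmoid_sub_one_le _).trans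
    (mul_le_mul_of_nonneg_left (spike_sub_sq_le s k e.1.1 e.1.2) zero_le_four)
  rw [add_comm, coe_winProb]
  refine le_trans (add_le_add_left (hsq.trans_eq ?_) 1) (Real.add_one_le_exp _)
  simp only [hmem, mul_ite, mul_one, mul_zero]

lemma observe_congr (b : ItemPair n → Bool) {y y' : ItemPair n → Fin L → Bool}
    (h : ∀ e, b e = true → y e = y' e) :
    observe (ofBits b, y) = observe (ofBits b, y') := by
  funext e
  simp only [observe, ofBits_adj_pair]
  by_cases he : b e = true
  · simp only [he, if_true, h e he]
  · simp only [he, if_false, Bool.false_eq_true]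

lemma sq_outcomeLaw_spike_real_le (k : Fin n) (b : ItemPair n → Bool) {D : ℝ}
    (hD : ∑ j, edgeWeight (ofBits b) k j ≤ D) {A : Set (ItemPair n → Fin L → Bool)}
    (hA : DependsOn (· ∈ A) {e | b e = true}) :
    (outcomeLaw L fun e : ItemPair n => winProb (spike s k) e.1.1 e.1.2).real A ^ 2
      ≤ Real.exp (4 * s ^ 2 * L * D) * (outcomeLaw L fun _ : ItemPair n => fairCoin).real A := by
  let q : ItemPair n → unitInterval := fun e =>
    if b e then winProb (spike s k) e.1.1 e.1.2 else fairCoin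
  have hbias : ∀ e, 1 + (2 * (q e : ℝ) - 1) ^ 2
      ≤ Real.exp (4 * s ^ 2 * if e ∈ crossing {k} then if b e then 1 else 0 else 0) := fun e => by
    by_cases hb : b e = true
    · simpa only [q, hb, if_true] using one_add_sq_two_mul_winProb_spike_sub_one_le k e
    · simp [q, hb, fairCoin]
  rw [outcomeLaw_real_congr (q' := q) (fun e he => (if_pos he).symm) hA]
  refine (sq_outcomeLaw_real_le q A).trans (mul_le_mul_of_nonneg_right ?_ measureReal_nonneg)
  calc ∏ e, (1 + (2 * (q e : ℝ) - 1) ^ 2) ^ L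
      ≤ ∏ e, Real.exp (4 * s ^ 2 * if e ∈ crossing {k} then if b e then 1 else 0 else 0) ^ L :=
        prod_le_prod (fun e _ => by positivity)
          fun e _ => pow_le_pow_left₀ (by positivity) (hbias e) L
    _ = Real.exp (4 * s ^ 2 * L * ∑ j, edgeWeight (ofBits b) k j) := by
        rw [sum_edgeWeight_ofBits, prod_pow, ← Real.exp_sum, ← Real.exp_nat_mul, ← mul_sum,
          sum_ite_mem, univ_inter]
        ring_nf
    _ ≤ Real.exp (4 * s ^ 2 * L * D) := Real.exp_le_exp.2 (by gcongr)

lemma sq_sum_outcomeLaw_spike_real_le (hs : 0 ≤ s) (est : Data n L → Fin n → ℝ)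
    {b : ItemPair n → Bool} {D : ℝ} (hD : ∀ i, ∑ j, edgeWeight (ofBits b) i j ≤ D) :
    (∑ k, (outcomeLaw L fun e : ItemPair n => winProb (spike s k) e.1.1 e.1.2).real
      {y | ‖est (observe (ofBits b, y)) - spike s k‖ < s / 2}) ^ 2
      ≤ n * Real.exp (4 * s ^ 2 * L * D) := by
  have hdisj : Pairwise fun k l : Fin n =>
      Disjoint {y : ItemPair n → Fin L → Bool | ‖est (observe (ofBits b, y)) - spike s k‖ < s / 2}
        {y | ‖est (observe (ofBits b, y)) - spike s l‖ < s / 2} := fun k l hkl => by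
    refine Set.disjoint_left.2 fun y hk hl => ?_
    rw [Set.mem_ofPred_eq] at hk hl
    have htri := norm_sub_le_norm_sub_add_norm_sub (spike s k) (est (observe (ofBits b, y)))
      (spike s l)
    rw [norm_sub_rev (spike s k) (est _)] at htri
    linarith [le_norm_spike_sub hs hkl]
  have h := sq_sum_measureReal_le hdisj (Real.exp_pos _).le fun k =>
    sq_outcomeLaw_spike_real_le (s := s) k b (hD k) fun y y' hy => by
      simp only [Set.mem_ofPred_eq, observe_congr b hy]
  rwa [Fintype.card_fin] at h

end Spikes

section Averaging

variable {α β : Type*} [MeasurableSpace α] [MeasurableSpace β]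

lemma prod_real_eq_integral {μ : Measure α} {ν : Measure β} [IsFiniteMeasure ν]
    {A : Set (α × β)} (hA : MeasurableSet A) :
    (μ.prod ν).real A = ∫ x, ν.real {y | (x, y) ∈ A} ∂μ := by
  rw [measureReal_def, Measure.prod_apply hA]
  exact (integral_toReal (measurable_measure_prodMk_left hA).aemeasurable
    (Filter.Eventually.of_forall fun x => measure_lt_top _ _)).symm

lemma sum_prod_real_le [Finite α] [MeasurableSingletonClass α] {ι : Type*} [Fintype ι]
    {μ : Measure α} {ν : ι → Measure β} [IsProbabilityMeasure μ]
    [∀ i, IsProbabilityMeasure (ν i)] {A : ι → Set (α × β)} (hA : ∀ i, MeasurableSet (A i))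
    {B : Set α} {a : ℝ} (ha : 0 ≤ a)
    (h : ∀ x ∉ B, ∑ i, (ν i).real {y | (x, y) ∈ A i} ≤ a) :
    ∑ i, (μ.prod (ν i)).real (A i) ≤ a + Fintype.card ι * μ.real B := by
  have hpt : ∀ x, ∑ i, (ν i).real {y | (x, y) ∈ A i}
      ≤ a + Fintype.card ι * B.indicator 1 x := fun x => by
    by_cases hx : x ∈ B
    · have hone : ∑ i, (ν i).real {y | (x, y) ∈ A i} ≤ ∑ _i : ι, (1 : ℝ) :=
        sum_le_sum fun i _ => measureReal_le_one
      simp only [sum_const, card_univ, nsmul_eq_mul, mul_one] at hone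
      simp only [Set.indicator_of_mem hx, Pi.one_apply]
      linarith
    · simpa only [Set.indicator_of_notMem hx, mul_zero, add_zero] using h x hx
  calc ∑ i, (μ.prod (ν i)).real (A i)
      = ∫ x, ∑ i, (ν i).real {y | (x, y) ∈ A i} ∂μ := by
        rw [integral_finsetSum _ fun i _ => Integrable.of_finite]
        exact sum_congr rfl fun i _ => prod_real_eq_integral (hA i)
    _ ≤ ∫ x, (a + Fintype.card ι * B.indicator 1 x) ∂μ :=
        integral_mono Integrable.of_finite Integrable.of_finite hpt
    _ = a + Fintype.card ι * μ.real B := by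
        rw [integral_add Integrable.of_finite Integrable.of_finite, integral_const_mul,
          integral_indicator_one (Set.toFinite B).measurableSet]
        simp only [integral_const, probReal_univ, one_smul]

end Averaging

section LowerBound

variable {n L : ℕ} {p : unitInterval} {C₁ C₂ κ s : ℝ}

lemma sum_bitSampleLaw_spike_real_le (hs : 0 ≤ s) (hn : 256 ≤ n) (hnp : 2 * Real.log n ≤ n * p)
    (hsep : 24 * (s ^ 2 * (L * (n * p))) ≤ Real.log n) (est : Data n L → Fin n → ℝ) :
    ∑ k, (bitSampleLaw L p (spike s k)).real
      {z | ‖est (observe (ofBits z.1, z.2)) - spike s k‖ < s / 2} ≤ n * (3 / 8) := by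
  have hn' : (256 : ℝ) ≤ n := by exact_mod_cast hn
  have hn0 : (0 : ℝ) < n := by linarith
  have hbad := bitLaw_exists_degree_gt_le p hnp
  have hexp : n * Real.exp (-(2 * Real.log n)) ≤ 1 / 8 := by
    rw [Real.exp_neg, ← Nat.cast_ofNat, Real.exp_nat_mul, Real.exp_log hn0, ← div_eq_mul_inv,
      div_le_div_iff₀ (by positivity) (by norm_num)]
    nlinarith
  have hgood : ∀ b ∉ {b : ItemPair n → Bool | ∃ i, 3 * ((n : ℝ) * p) <
      ∑ j, edgeWeight (ofBits b) i j},
      ∑ k, (outcomeLaw L fun e : ItemPair n => winProb (spike s k) e.1.1 e.1.2).real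
        {y | ‖est (observe (ofBits b, y)) - spike s k‖ < s / 2} ≤ n / 4 := fun b hb => by
    simp only [Set.mem_ofPred_eq, not_exists, not_lt] at hb
    refine le_of_sq_le_sq ?_ (by positivity)
    calc _ ≤ n * Real.exp (4 * s ^ 2 * L * (3 * (n * p))) :=
          sq_sum_outcomeLaw_spike_real_le hs est hb
      _ ≤ n * Real.exp (Real.log n / 2) := by gcongr; linarith
      _ = n * √n := by rw [Real.exp_half, Real.exp_log hn0]
      _ ≤ n * (n / 16) := by
        gcongr
        rw [Real.sqrt_le_left (by positivity)]
        nlinarith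
      _ = (n / 4) ^ 2 := by ring
  refine (sum_prod_real_le (fun k => (Set.toFinite _).measurableSet) (by positivity)
    hgood).trans ?_
  rw [Fintype.card_fin]
  linarith [mul_le_mul_of_nonneg_left (hbad.trans hexp) hn0.le]

lemma exists_half_le_sampleLaw_spike_real (hs : 0 ≤ s) (hn : 256 ≤ n)
    (hnp : 2 * Real.log n ≤ n * p) (hsep : 24 * (s ^ 2 * (L * (n * p))) ≤ Real.log n)
    (est : Data n L → Fin n → ℝ) :
    ∃ k : Fin n, 1 / 2 ≤ (sampleLaw L p (spike s k)).real
      {ω | s / 2 ≤ ‖est (observe ω) - spike s k‖} := by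
  by_contra! hcon
  have hsmall := sum_bitSampleLaw_spike_real_le hs hn hnp hsep est
  have hlarge : ∀ k : Fin n, 1 / 2 ≤ (bitSampleLaw L p (spike s k)).real
      {z | ‖est (observe (ofBits z.1, z.2)) - spike s k‖ < s / 2} := fun k => by
    have hcompl := probReal_compl_eq_one_sub (μ := bitSampleLaw L p (spike s k))
      (s := {z | s / 2 ≤ ‖est (observe (ofBits z.1, z.2)) - spike s k‖})
      (Set.toFinite _).measurableSet
    have hk := hcon k
    simp only [sampleLaw_real, Set.mem_ofPred_eq] at hk
    simp only [Set.compl_ofPred, not_le] at hcompl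
    linarith
  have hsum : (n : ℝ) * (1 / 2) ≤ ∑ k, (bitSampleLaw L p (spike s k)).real
      {z | ‖est (observe (ofBits z.1, z.2)) - spike s k‖ < s / 2} := by
    simpa using sum_le_sum fun k (_ : k ∈ univ) => hlarge k
  have hn0 : (0 : ℝ) < n := by positivity
  linarith

lemma Regime.exp_two_mul_mul_rate_le (hreg : Regime C₁ C₂ n L p) (hn : 2 ≤ n) (hC₂ : 0 < C₂)
    (hκ : 1 ≤ κ) {c : ℝ} (hc0 : 0 ≤ c) (hc : c ≤ √C₂ * Real.log κ / 3) :
    Real.exp (2 * c * rate n L p) ≤ κ := by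
  rw [← Real.le_log_iff_exp_le (by linarith)]
  refine le_of_sq_le_sq ?_ (Real.log_nonneg hκ)
  calc (2 * c * rate n L p) ^ 2 = 4 * c ^ 2 * rate n L p ^ 2 := by ring
    _ ≤ 4 * (√C₂ * Real.log κ / 3) ^ 2 * (2 / C₂) := by
      gcongr
      exact hreg.rate_sq_le hn hC₂
    _ = 8 / 9 * Real.log κ ^ 2 := by
      rw [div_pow, mul_pow, Real.sq_sqrt hC₂.le]
      field_simp
      ring
    _ ≤ Real.log κ ^ 2 := by linarith [sq_nonneg (Real.log κ)]

theorem exists_minimax_lower_bound (hκ : 1 < κ) (hC₁ : 512 ≤ C₁) (hC₂ : 0 < C₂) :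
    ∃ c > 0, ∀ (n L : ℕ) (p : unitInterval), Regime C₁ C₂ n L p →
      ∀ est : Data n L → Fin n → ℝ, ∃ θ ∈ scoreClass n κ,
        1 / 2 ≤ (sampleLaw L p θ).real {ω | c * rate n L p ≤ ‖est (observe ω) - θ‖} := by
  have hlogκ : 0 < Real.log κ := Real.log_pos hκ
  set c := min (1 / 10) (√C₂ * Real.log κ / 3)
  have hc : 0 < c := by positivity
  refine ⟨c, hc, fun n L p hreg est => ?_⟩
  rcases hreg.1.eq_or_lt with rfl | hn
  · refine ⟨spike 0 0, spike_mem_scoreClass le_rfl (by simpa using hκ.le) 0, ?_⟩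
    rw [sampleLaw_real]
    have hset : {z : (ItemPair 1 → Bool) × (ItemPair 1 → Fin L → Bool) |
        (ofBits z.1, z.2) ∈ {ω | c * rate 1 L p ≤ ‖est (observe ω) - spike 0 0‖}} = Set.univ := by
      simp [rate]
    rw [hset, probReal_univ]
    norm_num
  replace hn : 2 ≤ n := hn
  have hlog := half_le_log hn
  have hnp : 512 * Real.log n ≤ n * p := by
    refine le_trans ?_ hreg.mul_log_le
    gcongr
  have hn256 : 256 ≤ n := by
    have : (n : ℝ) * p ≤ n := mul_le_of_le_one_right (by positivity) p.2.2
    exact_mod_cast (by linarith : (256 : ℝ) ≤ n)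
  have hs : 0 ≤ 2 * c * rate n L p := mul_nonneg (by positivity) rate_nonneg
  have hκs := hreg.exp_two_mul_mul_rate_le hn hC₂ hκ.le hc.le (min_le_right _ _)
  have hsep : 24 * ((2 * c * rate n L p) ^ 2 * (L * (n * p))) ≤ Real.log n := by
    have hc10 : c ^ 2 ≤ (1 / 10) ^ 2 := by gcongr; exact min_le_left _ _
    calc 24 * ((2 * c * rate n L p) ^ 2 * (L * (n * p)))
        = 96 * c ^ 2 * (L * (n * p * rate n L p ^ 2)) := by ring
      _ = 96 * c ^ 2 * Real.log n := by rw [hreg.mul_rate_sq hn (by linarith)]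
      _ ≤ 1 * Real.log n := by gcongr; linarith
      _ = Real.log n := one_mul _
  obtain ⟨k, hk⟩ := exists_half_le_sampleLaw_spike_real hs hn256 (by linarith) hsep est
  refine ⟨spike (2 * c * rate n L p) k, spike_mem_scoreClass hs hκs k, ?_⟩
  have hhalf : 2 * c * rate n L p / 2 = c * rate n L p := by ring
  rwa [hhalf] at hk

end LowerBound

end BTL

end

theorem mainTheorem3 (κ₀ : ℝ) (hκ₀ : 1 ≤ κ₀) :
    ∃ C₁ > 0, ∃ C₂ > 0, ∃ C₃ > 0,
      -- the vanilla MLE exists, is unique and attains the rate, with high probability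
      (∀ (n L : ℕ) (p : unitInterval), BTL.Regime C₁ C₂ n L p →
        ∀ θstar ∈ BTL.scoreClass n κ₀,
          1 - 1 / (n : ℝ) ^ 10 ≤ (BTL.sampleLaw L p θstar).real
            {ω | ∃ θhat : Fin n → ℝ, BTL.IsMLE (BTL.observe ω) θhat ∧
              (∀ θ' : Fin n → ℝ, BTL.IsMLE (BTL.observe ω) θ' → θ' = θhat) ∧
              ‖θhat - θstar‖ ≤ C₃ * BTL.rate n L p}) ∧
      -- no estimator does better than the rate, up to a constant
      (1 < κ₀ → ∃ c > 0, ∀ (n L : ℕ) (p : unitInterval), BTL.Regime C₁ C₂ n L p →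
        ∀ est : BTL.Data n L → Fin n → ℝ, ∃ θstar ∈ BTL.scoreClass n κ₀,
          1 / 2 ≤ (BTL.sampleLaw L p θstar).real
            {ω | c * BTL.rate n L p ≤ ‖est (BTL.observe ω) - θstar‖}) := by
  refine ⟨BTL.degreeConst κ₀, BTL.degreeConst_pos κ₀, 8 * BTL.rateConst κ₀ ^ 2, ?_,
    BTL.rateConst κ₀, BTL.rateConst_pos κ₀,
    fun n L p hreg θstar hθ => BTL.isMLE_rate hκ₀ hreg hθ,
    fun hκ => BTL.exists_minimax_lower_bound hκ ?_ ?_⟩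
  · have := BTL.rateConst_pos κ₀
    positivity
  · linarith [BTL.le_degreeConst hκ₀]
  · have := BTL.rateConst_pos κ₀
    positivity
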